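/- Let $k$ be a field; coalgebras and tensor products are over $k$. For a coalgebra $C$ let $\mathcal M^C$ be the ($k$-linear) category of right $C$-comodules. A right $C$-comodule $M$ is *quasi-finite* if the space $\mathrm{Com}_C(Y,M)$ of comodule maps is finite dimensional for every finite dimensional right $C$-comodule $Y$. The *coendomorphism coalgebra* $e_{-C}(M)$ of a quasi-finite comodule $M$ is $h_{-C}(M,M)$, where $h_{-C}(M,-)$ is the left adjoint of $-\otimes M:\mathcal M_k\to\mathcal M^C$; that is, it is a vector space $E$ with a $C$-colinear map $\theta:M\to E\otimes M$ such that every $C$-colinear map $M\to W\otimes M$, with $W$ a vector space, equals $(g\otimes 1)\theta$ for a unique linear map $g:E\to W$, equipped with the coalgebra structure for which $\theta$ makes $M$ a left $E$-comodule. Two right $C$-comodules $M,N$ are *similar* if $M\oplus P\cong N^{(m)}$ and $N\oplus Q\cong M^{(n)}$ for some $m,n\in\mathbb N$ and right $C$-comodules $P,Q$, and $M$ is an *ingenerator* of $\mathcal M^C$ if it is similar to $C$. Coalgebras $A$ and $B$ are *strongly equivalent* if there are inverse $k$-linear equivalences $F:\mathcal M^A\rightleftarrows\mathcal M^B:G$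 such that $F(A)$ is an ingenerator of $\mathcal M^B$ and $G(B)$ is an ingenerator of $\mathcal M^A$. Let $\varphi:C\to D$ be a homomorphism of $k$-coalgebras; regard $C$ as a left and a right $D$-comodule via $\varphi$, and let $C\,\square_D\,C=\ker(\rho\otimes 1-1\otimes\lambda)\subseteq C\otimes C$ be the cotensor product, where $\rho:C\to C\otimes D$ and $\lambda:C\to D\otimes C$ are the coactions of $D$; it is a $(C,C)$-bicomodule. Call $\varphi$ *left* (respectively *right*) *codepth two* if $C\,\square_D\,C$ is isomorphic to a direct summand of a finite direct sum of copies of $C$ as a $(D,C)$-bicomodule (respectively as a $(C,D)$-bicomodule). **Theorem.** Let $\varphi:C\to D$ be a coalgebra homomorphism that is left or right codepth two, and suppose that $C_D$ and $(C\,\square_D\,C)_D$ are quasi-finite right $D$-comodules. Then the coendomorphism coalgebras $e_{-D}(C)$ and $e_{-D}(C\,\square_D\,C)$ exist and are strongly equivalent. -/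

import Mathlib

set_option linter.unusedSectionVars false

open TensorProduct CategoryTheory

universe u

namespace CoalgebraTheory

noncomputable section

section Coactions

variable {k : Type u} [Field k]
variable {A : Type u} [AddCommGroup A] [Module k A] [Coalgebra k A]
variable {B : Type u} [AddCommGroup B] [Module k B] [Coalgebra k B]
variable {A' : Type u} [AddCommGroup A'] [Module k A'] [Coalgebra k A']
variable {B' : Type u} [AddCommGroup B'] [Module k B'] [Coalgebra k B']
variable {M : Type u} [AddCommGroup M] [Module k M]
variable {N : Type u} [AddCommGroup N] [Module k N]

/-- `r : M → M ⊗ B` is a (coassociative and counital) right coaction of the coalgebra `B`. -/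
structure IsRightCoaction (r : M →ₗ[k] M ⊗[k] B) : Prop where
  coassoc : ∀ m, TensorProduct.assoc k M B B (r.rTensor B (r m)) =
    (Coalgebra.comul (R := k) (A := B)).lTensor M (r m)
  counit : ∀ m, (Coalgebra.counit (R := k) (A := B)).lTensor M (r m) = m ⊗ₜ[k] (1 : k)

/-- `l : M → A ⊗ M` is a (coassociative and counital) left coaction of the coalgebra `A`. -/
structure IsLeftCoaction (l : M →ₗ[k] A ⊗[k] M) : Prop where
  coassoc : ∀ m, TensorProduct.assoc k A A M
      ((Coalgebra.comul (R := k) (A := A)).rTensor M (l m)) = l.lTensor A (l m)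
  counit : ∀ m, (Coalgebra.counit (R := k) (A := A)).rTensor M (l m) = (1 : k) ⊗ₜ[k] m

/-- A left coaction `l` and a right coaction `r` on `M` are compatible:
`(1 ⊗ r) l = (l ⊗ 1) r`. -/
def CoactionsCommute (l : M →ₗ[k] A ⊗[k] M) (r : M →ₗ[k] M ⊗[k] B) : Prop :=
  ∀ m, r.lTensor A (l m) = TensorProduct.assoc k A M B (l.rTensor B (r m))

/-! ### Transport of the axioms along colinear maps -/

section Naturality

variable {rM : M →ₗ[k] M ⊗[k] B} {rN : N →ₗ[k] N ⊗[k] B}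
variable {lM : M →ₗ[k] A ⊗[k] M} {lN : N →ₗ[k] A ⊗[k] N} {f : N →ₗ[k] M}

theorem nat_right_assoc (h : rM ∘ₗ f = f.rTensor B ∘ₗ rN) (n : N) :
    TensorProduct.assoc k M B B (rM.rTensor B (rM (f n))) =
      f.rTensor (B ⊗[k] B) (TensorProduct.assoc k N B B (rN.rTensor B (rN n))) := by
  have h1 : rM (f n) = f.rTensor B (rN n) := LinearMap.congr_fun h n
  rw [h1, ← LinearMap.rTensor_comp_apply, h, LinearMap.rTensor_comp_apply]
  generalize rN.rTensor B (rN n) = t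
  have : (TensorProduct.assoc k M B B).toLinearMap ∘ₗ (f.rTensor B).rTensor B =
      f.rTensor (B ⊗[k] B) ∘ₗ (TensorProduct.assoc k N B B).toLinearMap := by
    ext; simp
  exact LinearMap.congr_fun this t

theorem nat_right {Z : Type u} [AddCommGroup Z] [Module k Z] (g : B →ₗ[k] Z)
    (h : rM ∘ₗ f = f.rTensor B ∘ₗ rN) (n : N) :
    g.lTensor M (rM (f n)) = f.rTensor Z (g.lTensor N (rN n)) := by
  have h1 : rM (f n) = f.rTensor B (rN n) := LinearMap.congr_fun h n
  rw [h1, ← LinearMap.comp_apply, ← LinearMap.comp_apply (f.rTensor Z),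
    LinearMap.lTensor_comp_rTensor, LinearMap.rTensor_comp_lTensor]

theorem nat_left_assoc (h : lM ∘ₗ f = f.lTensor A ∘ₗ lN) (n : N) :
    lM.lTensor A (lM (f n)) = (f.lTensor A).lTensor A (lN.lTensor A (lN n)) := by
  have h1 : lM (f n) = f.lTensor A (lN n) := LinearMap.congr_fun h n
  rw [h1, ← LinearMap.lTensor_comp_apply, h, LinearMap.lTensor_comp_apply]

theorem nat_left {Z : Type u} [AddCommGroup Z] [Module k Z] (g : A →ₗ[k] Z)
    (h : lM ∘ₗ f = f.lTensor A ∘ₗ lN) (n : N) :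
    g.rTensor M (lM (f n)) = f.lTensor Z (g.rTensor N (lN n)) := by
  have h1 : lM (f n) = f.lTensor A (lN n) := LinearMap.congr_fun h n
  rw [h1, ← LinearMap.comp_apply, ← LinearMap.comp_apply (f.lTensor Z),
    LinearMap.lTensor_comp_rTensor, LinearMap.rTensor_comp_lTensor]

theorem assoc_lTensor_lTensor (t : (A ⊗[k] A') ⊗[k] N) :
    TensorProduct.assoc k A A' M (f.lTensor (A ⊗[k] A') t) =
      (f.lTensor A').lTensor A (TensorProduct.assoc k A A' N t) := by
  have : (TensorProduct.assoc k A A' M).toLinearMap ∘ₗ f.lTensor (A ⊗[k] A') =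
      (f.lTensor A').lTensor A ∘ₗ (TensorProduct.assoc k A A' N).toLinearMap := by
    ext; simp
  exact LinearMap.congr_fun this t

theorem assoc_lTensor_rTensor (t : (A ⊗[k] N) ⊗[k] B) :
    TensorProduct.assoc k A M B ((f.lTensor A).rTensor B t) =
      (f.rTensor B).lTensor A (TensorProduct.assoc k A N B t) := by
  have : (TensorProduct.assoc k A M B).toLinearMap ∘ₗ (f.lTensor A).rTensor B =
      (f.rTensor B).lTensor A ∘ₗ (TensorProduct.assoc k A N B).toLinearMap := by
    ext; simp
  exact LinearMap.congr_fun this t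

theorem right_at (h : rM ∘ₗ f = f.rTensor B ∘ₗ rN) (hN : IsRightCoaction rN) (n : N) :
    TensorProduct.assoc k M B B (rM.rTensor B (rM (f n))) =
      (Coalgebra.comul (R := k) (A := B)).lTensor M (rM (f n)) ∧
    (Coalgebra.counit (R := k) (A := B)).lTensor M (rM (f n)) = f n ⊗ₜ[k] (1 : k) := by
  rw [nat_right_assoc h, hN.coassoc, nat_right _ h, nat_right _ h, hN.counit]
  simp

theorem left_at (h : lM ∘ₗ f = f.lTensor A ∘ₗ lN) (hN : IsLeftCoaction lN) (n : N) :
    TensorProduct.assoc k A A M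
      ((Coalgebra.comul (R := k) (A := A)).rTensor M (lM (f n))) = lM.lTensor A (lM (f n)) ∧
    (Coalgebra.counit (R := k) (A := A)).rTensor M (lM (f n)) = (1 : k) ⊗ₜ[k] f n := by
  rw [nat_left_assoc h, ← hN.coassoc, nat_left _ h, nat_left _ h, hN.counit,
    assoc_lTensor_lTensor]
  simp

theorem nat_commute₁ (hl : lM ∘ₗ f = f.lTensor A ∘ₗ lN) (hr : rM ∘ₗ f = f.rTensor B ∘ₗ rN)
    (n : N) : rM.lTensor A (lM (f n)) = (f.rTensor B).lTensor A (rN.lTensor A (lN n)) := by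
  have h1 : lM (f n) = f.lTensor A (lN n) := LinearMap.congr_fun hl n
  rw [h1, ← LinearMap.lTensor_comp_apply, hr, LinearMap.lTensor_comp_apply]

theorem nat_commute₂ (hl : lM ∘ₗ f = f.lTensor A ∘ₗ lN) (hr : rM ∘ₗ f = f.rTensor B ∘ₗ rN)
    (n : N) : TensorProduct.assoc k A M B (lM.rTensor B (rM (f n))) =
      (f.rTensor B).lTensor A (TensorProduct.assoc k A N B (lN.rTensor B (rN n))) := by
  have h1 : rM (f n) = f.rTensor B (rN n) := LinearMap.congr_fun hr n
  rw [h1, ← LinearMap.rTensor_comp_apply, hl, LinearMap.rTensor_comp_apply,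
    assoc_lTensor_rTensor]

theorem commute_at (hl : lM ∘ₗ f = f.lTensor A ∘ₗ lN) (hr : rM ∘ₗ f = f.rTensor B ∘ₗ rN)
    (hN : CoactionsCommute lN rN) (n : N) :
    rM.lTensor A (lM (f n)) = TensorProduct.assoc k A M B (lM.rTensor B (rM (f n))) := by
  rw [nat_commute₁ hl hr, nat_commute₂ hl hr, hN]

theorem IsRightCoaction.of_injective (h : rM ∘ₗ f = f.rTensor B ∘ₗ rN)
    (hf : Function.Injective f) (hM : IsRightCoaction rM) : IsRightCoaction rN where
  coassoc n := by
    apply Module.Flat.rTensor_preserves_injective_linearMap (M := B ⊗[k] B) f hf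
    rw [← nat_right_assoc h, ← nat_right _ h, hM.coassoc]
  counit n := by
    apply Module.Flat.rTensor_preserves_injective_linearMap (M := k) f hf
    rw [← nat_right _ h, hM.counit, LinearMap.rTensor_tmul]

theorem IsLeftCoaction.of_injective (h : lM ∘ₗ f = f.lTensor A ∘ₗ lN)
    (hf : Function.Injective f) (hM : IsLeftCoaction lM) : IsLeftCoaction lN where
  coassoc n := by
    apply Module.Flat.lTensor_preserves_injective_linearMap (M := A) (f.lTensor A)
      (Module.Flat.lTensor_preserves_injective_linearMap (M := A) f hf)
    rw [← nat_left_assoc h, ← assoc_lTensor_lTensor, ← nat_left _ h, hM.coassoc]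
  counit n := by
    apply Module.Flat.lTensor_preserves_injective_linearMap (M := k) f hf
    rw [← nat_left _ h, hM.counit, LinearMap.lTensor_tmul]

theorem CoactionsCommute.of_injective (hl : lM ∘ₗ f = f.lTensor A ∘ₗ lN)
    (hr : rM ∘ₗ f = f.rTensor B ∘ₗ rN) (hf : Function.Injective f)
    (hM : CoactionsCommute lM rM) : CoactionsCommute lN rN := fun n => by
  apply Module.Flat.lTensor_preserves_injective_linearMap (M := A) (f.rTensor B)
    (Module.Flat.rTensor_preserves_injective_linearMap (M := B) f hf)
  rw [← nat_commute₁ hl hr, ← nat_commute₂ hl hr, hM]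

end Naturality

/-! ### Direct sums of coactions -/

/-- The right coaction on `M ⊕ N`. -/
def prodRight (rM : M →ₗ[k] M ⊗[k] B) (rN : N →ₗ[k] N ⊗[k] B) :
    M × N →ₗ[k] (M × N) ⊗[k] B :=
  ((LinearMap.inl k M N).rTensor B ∘ₗ rM).coprod ((LinearMap.inr k M N).rTensor B ∘ₗ rN)

/-- The left coaction on `M ⊕ N`. -/
def prodLeft (lM : M →ₗ[k] A ⊗[k] M) (lN : N →ₗ[k] A ⊗[k] N) :
    M × N →ₗ[k] A ⊗[k] (M × N) :=
  ((LinearMap.inl k M N).lTensor A ∘ₗ lM).coprod ((LinearMap.inr k M N).lTensor A ∘ₗ lN)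

/-- The right coaction on `M^n`. -/
def powRight (n : ℕ) (r : M →ₗ[k] M ⊗[k] B) : (Fin n → M) →ₗ[k] (Fin n → M) ⊗[k] B :=
  ∑ i, (LinearMap.single k (fun _ => M) i).rTensor B ∘ₗ r ∘ₗ LinearMap.proj i

/-- The left coaction on `M^n`. -/
def powLeft (n : ℕ) (l : M →ₗ[k] A ⊗[k] M) : (Fin n → M) →ₗ[k] A ⊗[k] (Fin n → M) :=
  ∑ i, (LinearMap.single k (fun _ => M) i).lTensor A ∘ₗ l ∘ₗ LinearMap.proj i

section DirectSums

variable {rM : M →ₗ[k] M ⊗[k] B} {rN : N →ₗ[k] N ⊗[k] B}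
variable {lM : M →ₗ[k] A ⊗[k] M} {lN : N →ₗ[k] A ⊗[k] N}

theorem prod_decomp (x : M × N) : x = LinearMap.inl k M N x.1 + LinearMap.inr k M N x.2 := by
  simp

theorem pow_decomp {n : ℕ} (x : Fin n → M) :
    x = ∑ i, LinearMap.single k (fun _ => M) i (x i) :=
  (Finset.univ_sum_single x).symm

theorem powRight_single {n : ℕ} (i : Fin n) :
    powRight n rM ∘ₗ LinearMap.single k (fun _ => M) i =
      (LinearMap.single k (fun _ => M) i).rTensor B ∘ₗ rM := by
  ext m
  simp only [powRight, LinearMap.comp_apply, LinearMap.sum_apply, LinearMap.proj_apply]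
  rw [Finset.sum_eq_single i]
  · simp
  · intro j _ hj
    simp [hj]
  · simp

theorem powLeft_single {n : ℕ} (i : Fin n) :
    powLeft n lM ∘ₗ LinearMap.single k (fun _ => M) i =
      (LinearMap.single k (fun _ => M) i).lTensor A ∘ₗ lM := by
  ext m
  simp only [powLeft, LinearMap.comp_apply, LinearMap.sum_apply, LinearMap.proj_apply]
  rw [Finset.sum_eq_single i]
  · simp
  · intro j _ hj
    simp [hj]
  · simp

theorem IsRightCoaction.prod (hM : IsRightCoaction rM) (hN : IsRightCoaction rN) :
    IsRightCoaction (prodRight rM rN) := by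
  have h1 := right_at (f := LinearMap.inl k M N) (rM := prodRight rM rN)
    (LinearMap.coprod_inl _ _) hM
  have h2 := right_at (f := LinearMap.inr k M N) (rM := prodRight rM rN)
    (LinearMap.coprod_inr _ _) hN
  constructor <;> intro x <;> rw [prod_decomp (k := k) x]
  · simp only [map_add, (h1 _).1, (h2 _).1]
  · simp only [map_add, (h1 _).2, (h2 _).2, TensorProduct.add_tmul]

theorem IsLeftCoaction.prod (hM : IsLeftCoaction lM) (hN : IsLeftCoaction lN) :
    IsLeftCoaction (prodLeft lM lN) := by
  have h1 := left_at (f := LinearMap.inl k M N) (lM := prodLeft lM lN)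
    (LinearMap.coprod_inl _ _) hM
  have h2 := left_at (f := LinearMap.inr k M N) (lM := prodLeft lM lN)
    (LinearMap.coprod_inr _ _) hN
  constructor <;> intro x <;> rw [prod_decomp (k := k) x]
  · simp only [map_add, (h1 _).1, (h2 _).1]
  · simp only [map_add, (h1 _).2, (h2 _).2, TensorProduct.tmul_add]

theorem CoactionsCommute.prod (hM : CoactionsCommute lM rM) (hN : CoactionsCommute lN rN) :
    CoactionsCommute (prodLeft lM lN) (prodRight rM rN) := by
  have h1 := commute_at (f := LinearMap.inl k M N) (lM := prodLeft lM lN)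
    (rM := prodRight rM rN) (LinearMap.coprod_inl _ _) (LinearMap.coprod_inl _ _) hM
  have h2 := commute_at (f := LinearMap.inr k M N) (lM := prodLeft lM lN)
    (rM := prodRight rM rN) (LinearMap.coprod_inr _ _) (LinearMap.coprod_inr _ _) hN
  intro x
  rw [prod_decomp (k := k) x]
  simp only [map_add, h1, h2]

theorem IsRightCoaction.pow (n : ℕ) (hM : IsRightCoaction rM) :
    IsRightCoaction (powRight n rM) := by
  have h := fun i : Fin n => right_at (powRight_single i) hM
  constructor <;> intro x <;> rw [pow_decomp (k := k) x]
  · simp only [map_sum, (h _ _).1]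
  · simp only [map_sum, (h _ _).2, TensorProduct.sum_tmul]

theorem IsLeftCoaction.pow (n : ℕ) (hM : IsLeftCoaction lM) :
    IsLeftCoaction (powLeft n lM) := by
  have h := fun i : Fin n => left_at (powLeft_single i) hM
  constructor <;> intro x <;> rw [pow_decomp (k := k) x]
  · simp only [map_sum, (h _ _).1]
  · simp only [map_sum, (h _ _).2, TensorProduct.tmul_sum]

theorem CoactionsCommute.pow (n : ℕ) (hM : CoactionsCommute lM rM) :
    CoactionsCommute (powLeft n lM) (powRight n rM) := by
  have h := fun i : Fin n => commute_at (powLeft_single i) (powRight_single i) hM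
  intro x
  rw [pow_decomp (k := k) x]
  simp only [map_sum, h]

end DirectSums

/-! ### Corestriction of coactions along coalgebra homomorphisms -/

/-- The right `B'`-coaction `(1 ⊗ g) r` induced by a right `B`-coaction `r` and `g : B → B'`. -/
def corestrictRight (g : B →ₗc[k] B') (r : M →ₗ[k] M ⊗[k] B) : M →ₗ[k] M ⊗[k] B' :=
  g.toLinearMap.lTensor M ∘ₗ r

/-- The left `A'`-coaction `(f ⊗ 1) l` induced by a left `A`-coaction `l` and `f : A → A'`. -/
def corestrictLeft (f : A →ₗc[k] A') (l : M →ₗ[k] A ⊗[k] M) : M →ₗ[k] A' ⊗[k] M :=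
  f.toLinearMap.rTensor M ∘ₗ l

theorem IsRightCoaction.corestrict (g : B →ₗc[k] B') {r : M →ₗ[k] M ⊗[k] B}
    (hr : IsRightCoaction r) : IsRightCoaction (corestrictRight g r) where
  coassoc m := by
    have h1 : TensorProduct.assoc k M B' B'
        ((corestrictRight g r).rTensor B' (corestrictRight g r m)) =
        (TensorProduct.map g.toLinearMap g.toLinearMap).lTensor M
          (TensorProduct.assoc k M B B (r.rTensor B (r m))) := by
      have : (TensorProduct.assoc k M B' B').toLinearMap ∘ₗ
          (g.toLinearMap.lTensor M).rTensor B' ∘ₗ g.toLinearMap.lTensor (M ⊗[k] B) =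
          (TensorProduct.map g.toLinearMap g.toLinearMap).lTensor M ∘ₗ
            (TensorProduct.assoc k M B B).toLinearMap := by
        ext; simp
      have h2 := LinearMap.congr_fun this (r.rTensor B (r m))
      simp only [LinearMap.comp_apply, LinearEquiv.coe_coe] at h2
      rw [← h2, corestrictRight, LinearMap.rTensor_comp_apply, LinearMap.comp_apply]
      congr 2
      rw [← LinearMap.comp_apply, ← LinearMap.comp_apply (g.toLinearMap.lTensor (M ⊗[k] B)),
        LinearMap.lTensor_comp_rTensor, LinearMap.rTensor_comp_lTensor]
    rw [h1, hr.coassoc, corestrictRight, LinearMap.comp_apply, ← LinearMap.lTensor_comp_apply,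
      ← LinearMap.lTensor_comp_apply, g.map_comp_comul]
  counit m := by
    rw [corestrictRight, LinearMap.comp_apply, ← LinearMap.lTensor_comp_apply, g.counit_comp,
      hr.counit]

theorem IsLeftCoaction.corestrict (f : A →ₗc[k] A') {l : M →ₗ[k] A ⊗[k] M}
    (hl : IsLeftCoaction l) : IsLeftCoaction (corestrictLeft f l) where
  coassoc m := by
    have h1 : (corestrictLeft f l).lTensor A' (corestrictLeft f l m) =
        TensorProduct.assoc k A' A' M
          ((TensorProduct.map f.toLinearMap f.toLinearMap).rTensor M
            ((TensorProduct.assoc k A A M).symm (l.lTensor A (l m)))) := by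
      have : (f.toLinearMap.rTensor M).lTensor A' ∘ₗ f.toLinearMap.rTensor (A ⊗[k] M) =
          (TensorProduct.assoc k A' A' M).toLinearMap ∘ₗ
          (TensorProduct.map f.toLinearMap f.toLinearMap).rTensor M ∘ₗ
            (TensorProduct.assoc k A A M).symm.toLinearMap := by
        ext; simp
      have h2 := LinearMap.congr_fun this (l.lTensor A (l m))
      simp only [LinearMap.comp_apply, LinearEquiv.coe_coe] at h2
      rw [← h2, corestrictLeft, LinearMap.lTensor_comp_apply, LinearMap.comp_apply]
      congr 1
      rw [← LinearMap.comp_apply, ← LinearMap.comp_apply (f.toLinearMap.rTensor (A ⊗[k] M)),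
        LinearMap.lTensor_comp_rTensor, LinearMap.rTensor_comp_lTensor]
    rw [h1, ← hl.coassoc, LinearEquiv.symm_apply_apply, corestrictLeft, LinearMap.comp_apply,
      ← LinearMap.rTensor_comp_apply, ← LinearMap.rTensor_comp_apply, f.map_comp_comul]
  counit m := by
    rw [corestrictLeft, LinearMap.comp_apply, ← LinearMap.rTensor_comp_apply, f.counit_comp,
      hl.counit]

theorem CoactionsCommute.corestrict (f : A →ₗc[k] A') (g : B →ₗc[k] B')
    {l : M →ₗ[k] A ⊗[k] M} {r : M →ₗ[k] M ⊗[k] B} (h : CoactionsCommute l r) :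
    CoactionsCommute (corestrictLeft f l) (corestrictRight g r) := fun m => by
  have e1 : (corestrictRight g r).lTensor A' (corestrictLeft f l m) =
      (TensorProduct.map f.toLinearMap (g.toLinearMap.lTensor M)) (r.lTensor A (l m)) := by
    have : (corestrictRight g r).lTensor A' ∘ₗ f.toLinearMap.rTensor M =
        (TensorProduct.map f.toLinearMap (g.toLinearMap.lTensor M)) ∘ₗ r.lTensor A := by
      ext; simp [corestrictRight]
    exact LinearMap.congr_fun this (l m)
  have e2 : TensorProduct.assoc k A' M B'
      ((corestrictLeft f l).rTensor B' (corestrictRight g r m)) =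
      (TensorProduct.map f.toLinearMap (g.toLinearMap.lTensor M))
        (TensorProduct.assoc k A M B (l.rTensor B (r m))) := by
    have h3 : (TensorProduct.assoc k A' M B').toLinearMap ∘ₗ
        TensorProduct.map (f.toLinearMap.rTensor M) g.toLinearMap =
        (TensorProduct.map f.toLinearMap (g.toLinearMap.lTensor M)) ∘ₗ
          (TensorProduct.assoc k A M B).toLinearMap := by
      ext; simp
    have h4 : (corestrictLeft f l).rTensor B' ∘ₗ g.toLinearMap.lTensor M =
        TensorProduct.map (f.toLinearMap.rTensor M) g.toLinearMap ∘ₗ l.rTensor B := by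
      ext; simp [corestrictLeft]
    have h5 := LinearMap.congr_fun h3 (l.rTensor B (r m))
    have h6 := LinearMap.congr_fun h4 (r m)
    simp only [LinearMap.comp_apply, LinearEquiv.coe_coe] at h5 h6
    rw [← h5, ← h6]
    rfl
  rw [e1, e2, h]

/-! ### Coactions on tensor products and cotensor products -/

/-- The right coaction `1 ⊗ r` on `M ⊗ N`. -/
def tensorRight (M : Type u) [AddCommGroup M] [Module k M] (r : N →ₗ[k] N ⊗[k] B) :
    M ⊗[k] N →ₗ[k] (M ⊗[k] N) ⊗[k] B :=
  (TensorProduct.assoc k M N B).symm.toLinearMap ∘ₗ r.lTensor M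

/-- The left coaction `l ⊗ 1` on `M ⊗ N`. -/
def tensorLeft (N : Type u) [AddCommGroup N] [Module k N] (l : M →ₗ[k] A ⊗[k] M) :
    M ⊗[k] N →ₗ[k] A ⊗[k] (M ⊗[k] N) :=
  (TensorProduct.assoc k A M N).toLinearMap ∘ₗ l.rTensor N

theorem IsRightCoaction.tensor {r : N →ₗ[k] N ⊗[k] B} (hr : IsRightCoaction r) :
    IsRightCoaction (tensorRight M r) := by
  have key : ∀ m : M, tensorRight M r ∘ₗ TensorProduct.mk k M N m =
      (TensorProduct.mk k M N m).rTensor B ∘ₗ r := by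
    intro m
    have : (TensorProduct.assoc k M N B).symm.toLinearMap ∘ₗ TensorProduct.mk k M (N ⊗[k] B) m =
        (TensorProduct.mk k M N m).rTensor B := by
      ext; simp
    rw [← this]
    rfl
  have h := fun m => right_at (key m) hr
  simp only [TensorProduct.mk_apply] at h
  constructor <;> intro x
  · induction x with
    | zero => simp
    | add x y hx hy => simp only [map_add, hx, hy]
    | tmul x y => exact (h x y).1
  · induction x with
    | zero => simp
    | add x y hx hy => simp only [map_add, hx, hy, TensorProduct.add_tmul]
    | tmul x y => exact (h x y).2

theorem IsLeftCoaction.tensor {l : M →ₗ[k] A ⊗[k] M} (hl : IsLeftCoaction l) :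
    IsLeftCoaction (tensorLeft N l) := by
  have key : ∀ n : N, tensorLeft N l ∘ₗ (TensorProduct.mk k M N).flip n =
      ((TensorProduct.mk k M N).flip n).lTensor A ∘ₗ l := by
    intro n
    have : (TensorProduct.assoc k A M N).toLinearMap ∘ₗ
        (TensorProduct.mk k (A ⊗[k] M) N).flip n =
        ((TensorProduct.mk k M N).flip n).lTensor A := by
      ext; simp
    rw [← this]
    rfl
  have h := fun n => left_at (key n) hl
  simp only [TensorProduct.mk_apply, LinearMap.flip_apply] at h
  constructor <;> intro x
  · induction x with
    | zero => simp
    | add x y hx hy => simp only [map_add, hx, hy]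
    | tmul x y => exact (h y x).1
  · induction x with
    | zero => simp
    | add x y hx hy => simp only [map_add, hx, hy, TensorProduct.tmul_add]
    | tmul x y => exact (h y x).2

theorem CoactionsCommute.tensor (l : M →ₗ[k] A ⊗[k] M) (r : N →ₗ[k] N ⊗[k] B) :
    CoactionsCommute (tensorLeft N l) (tensorRight M r) := by
  intro x
  induction x with
  | zero => simp
  | add x y hx hy => simp only [map_add, hx, hy]
  | tmul x y =>
    simp only [tensorLeft, tensorRight, LinearMap.comp_apply, LinearMap.rTensor_tmul,
      LinearMap.lTensor_tmul, LinearEquiv.coe_coe, LinearMap.lTensor_comp_apply,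
      LinearMap.rTensor_comp_apply]
    generalize hs : l x = s
    generalize ht : r y = t
    have e1 : ∀ s : A ⊗[k] M, ((TensorProduct.assoc k M N B).symm.toLinearMap.lTensor A)
        ((r.lTensor M).lTensor A (TensorProduct.assoc k A M N (s ⊗ₜ[k] y))) =
        ((TensorProduct.assoc k M N B).symm.toLinearMap.lTensor A)
        (TensorProduct.assoc k A M (N ⊗[k] B) (s ⊗ₜ[k] t)) := by
      intro s
      induction s with
      | zero => simp
      | add s s' h h' => simp only [TensorProduct.add_tmul, map_add, h, h']
      | tmul a m => simp [ht]
    have e2 : ∀ t : N ⊗[k] B, ((TensorProduct.assoc k A M N).toLinearMap.rTensor B)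
        ((l.rTensor N).rTensor B ((TensorProduct.assoc k M N B).symm (x ⊗ₜ[k] t))) =
        ((TensorProduct.assoc k A M N).toLinearMap.rTensor B)
        ((TensorProduct.assoc k (A ⊗[k] M) N B).symm (s ⊗ₜ[k] t)) := by
      intro t
      induction t with
      | zero => simp
      | add s s' h h' => simp only [TensorProduct.tmul_add, map_add, h, h']
      | tmul a m => simp [hs]
    rw [e1, e2]
    clear e1 e2 hs ht
    induction s with
    | zero => simp
    | add s s' h h' => simp only [TensorProduct.add_tmul, map_add, h, h']
    | tmul a m =>
      induction t with
      | zero => simp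
      | add s s' h h' => simp only [TensorProduct.tmul_add, map_add, h, h']
      | tmul n b => simp

/-- The map `r ⊗ 1 - 1 ⊗ l : M ⊗ N → M ⊗ B ⊗ N` whose kernel is the cotensor product. -/
def cotensorMap (r : M →ₗ[k] M ⊗[k] B) (l : N →ₗ[k] B ⊗[k] N) :
    M ⊗[k] N →ₗ[k] M ⊗[k] (B ⊗[k] N) :=
  (TensorProduct.assoc k M B N).toLinearMap ∘ₗ r.rTensor N - l.lTensor M

/-- The cotensor product `M □_B N` of a right `B`-comodule `M` and a left `B`-comodule `N`. -/
def cotensorSubmodule (r : M →ₗ[k] M ⊗[k] B) (l : N →ₗ[k] B ⊗[k] N) :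
    Submodule k (M ⊗[k] N) :=
  LinearMap.ker (cotensorMap r l)

/-- The restriction of a right coaction `r` on `M` to a subspace `K` with `r(K) ⊆ K ⊗ B`. -/
def restrictRight (r : M →ₗ[k] M ⊗[k] B) (K : Submodule k M)
    (h : ∀ x : K, r x ∈ LinearMap.range (K.subtype.rTensor B)) : K →ₗ[k] K ⊗[k] B :=
  (LinearEquiv.ofInjective (K.subtype.rTensor B)
    (Module.Flat.rTensor_preserves_injective_linearMap _ K.injective_subtype)).symm.toLinearMap ∘ₗ
    (r ∘ₗ K.subtype).codRestrict _ h

/-- The restriction of a left coaction `l` on `M` to a subspace `K` with `l(K) ⊆ A ⊗ K`. -/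
def restrictLeft (l : M →ₗ[k] A ⊗[k] M) (K : Submodule k M)
    (h : ∀ x : K, l x ∈ LinearMap.range (K.subtype.lTensor A)) : K →ₗ[k] A ⊗[k] K :=
  (LinearEquiv.ofInjective (K.subtype.lTensor A)
    (Module.Flat.lTensor_preserves_injective_linearMap _ K.injective_subtype)).symm.toLinearMap ∘ₗ
    (l ∘ₗ K.subtype).codRestrict _ h

theorem restrictRight_spec (r : M →ₗ[k] M ⊗[k] B) (K : Submodule k M)
    (h : ∀ x : K, r x ∈ LinearMap.range (K.subtype.rTensor B)) :
    r ∘ₗ K.subtype = K.subtype.rTensor B ∘ₗ restrictRight r K h := by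
  ext x
  simp only [restrictRight, LinearMap.comp_apply, LinearEquiv.coe_coe]
  rw [← LinearEquiv.ofInjective_apply (h := Module.Flat.rTensor_preserves_injective_linearMap _
    K.injective_subtype), LinearEquiv.apply_symm_apply]
  rfl

theorem restrictLeft_spec (l : M →ₗ[k] A ⊗[k] M) (K : Submodule k M)
    (h : ∀ x : K, l x ∈ LinearMap.range (K.subtype.lTensor A)) :
    l ∘ₗ K.subtype = K.subtype.lTensor A ∘ₗ restrictLeft l K h := by
  ext x
  simp only [restrictLeft, LinearMap.comp_apply, LinearEquiv.coe_coe]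
  rw [← LinearEquiv.ofInjective_apply (h := Module.Flat.lTensor_preserves_injective_linearMap _
    K.injective_subtype), LinearEquiv.apply_symm_apply]
  rfl

theorem cotensor_right_mem {rM : M →ₗ[k] M ⊗[k] B} {lN : N →ₗ[k] B ⊗[k] N}
    {rN : N →ₗ[k] N ⊗[k] B'} (h : CoactionsCommute lN rN) (x : cotensorSubmodule rM lN) :
    tensorRight M rN x ∈
      LinearMap.range ((cotensorSubmodule rM lN).subtype.rTensor B') := by
  have hex : Function.Exact (cotensorSubmodule rM lN).subtype (cotensorMap rM lN) :=
    LinearMap.exact_subtype_ker_map _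
  have hex' := Module.Flat.rTensor_exact B' hex
  refine (hex' _).1 ?_
  have key : ∀ z : M ⊗[k] N, (cotensorMap rM lN).rTensor B' (tensorRight M rN z) =
      (TensorProduct.assoc k M (B ⊗[k] N) B').symm
        (((TensorProduct.assoc k B N B').symm.toLinearMap.lTensor M)
          ((rN.lTensor B).lTensor M (cotensorMap rM lN z))) := by
    intro z
    induction z with
    | zero => simp
    | add x y hx hy => simp only [map_add, hx, hy]
    | tmul m n =>
      simp only [cotensorMap, tensorRight, LinearMap.rTensor_sub, LinearMap.sub_apply, map_sub,
        LinearMap.comp_apply, LinearMap.rTensor_tmul, LinearMap.lTensor_tmul,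
        LinearEquiv.coe_coe, LinearMap.rTensor_comp_apply, h n]
      congr 1
      · have e : ∀ s : M ⊗[k] B, (rN.lTensor B).lTensor M
            (TensorProduct.assoc k M B N (s ⊗ₜ[k] n)) =
            TensorProduct.assoc k M B (N ⊗[k] B') (s ⊗ₜ[k] rN n) := by
          intro s
          induction s with
          | zero => simp
          | add s s' h h' => simp only [TensorProduct.add_tmul, map_add, h, h']
          | tmul a b => simp
        have e' : ∀ t : N ⊗[k] B', (rM.rTensor N).rTensor B'
            ((TensorProduct.assoc k M N B').symm (m ⊗ₜ[k] t)) =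
            (TensorProduct.assoc k (M ⊗[k] B) N B').symm (rM m ⊗ₜ[k] t) := by
          intro t
          induction t with
          | zero => simp
          | add s s' h h' => simp only [TensorProduct.tmul_add, map_add, h, h']
          | tmul a b => simp
        rw [e, e']
        generalize rM m = s
        generalize rN n = t
        induction s with
        | zero => simp
        | add s s' h h' => simp only [TensorProduct.add_tmul, map_add, h, h']
        | tmul a b =>
          induction t with
          | zero => simp
          | add s s' h h' => simp only [TensorProduct.tmul_add, map_add, h, h']
          | tmul c d => simp
      · generalize rN n = t
        induction t with
        | zero => simp
        | add s s' h h' => simp only [TensorProduct.tmul_add, map_add, h, h']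
        | tmul a b =>
          simp only [LinearMap.rTensor_tmul, TensorProduct.assoc_symm_tmul,
            LinearMap.lTensor_tmul, LinearEquiv.symm_apply_apply]
  rw [key, show cotensorMap rM lN x = 0 from x.2]
  simp

theorem cotensor_left_mem {rM : M →ₗ[k] M ⊗[k] B} {lN : N →ₗ[k] B ⊗[k] N}
    {lM : M →ₗ[k] A ⊗[k] M} (h : CoactionsCommute lM rM) (x : cotensorSubmodule rM lN) :
    tensorLeft N lM x ∈
      LinearMap.range ((cotensorSubmodule rM lN).subtype.lTensor A) := by
  have hex : Function.Exact (cotensorSubmodule rM lN).subtype (cotensorMap rM lN) :=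
    LinearMap.exact_subtype_ker_map _
  have hex' := Module.Flat.lTensor_exact A hex
  refine (hex' _).1 ?_
  have key : ∀ z : M ⊗[k] N, (cotensorMap rM lN).lTensor A (tensorLeft N lM z) =
      TensorProduct.assoc k A M (B ⊗[k] N) (lM.rTensor (B ⊗[k] N) (cotensorMap rM lN z)) := by
    intro z
    induction z with
    | zero => simp
    | add x y hx hy => simp only [map_add, hx, hy]
    | tmul m n =>
      simp only [cotensorMap, tensorLeft, LinearMap.lTensor_sub, LinearMap.sub_apply, map_sub,
        LinearMap.comp_apply, LinearMap.rTensor_tmul, LinearMap.lTensor_tmul,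
        LinearEquiv.coe_coe, LinearMap.lTensor_comp_apply]
      congr 1
      · have e : ∀ s : A ⊗[k] M, (rM.rTensor N).lTensor A
            (TensorProduct.assoc k A M N (s ⊗ₜ[k] n)) =
            TensorProduct.assoc k A (M ⊗[k] B) N (rM.lTensor A s ⊗ₜ[k] n) := by
          intro s
          induction s with
          | zero => simp
          | add s s' h h' => simp only [TensorProduct.add_tmul, map_add, h, h']
          | tmul a b => simp
        rw [e, h m]
        generalize rM m = s
        induction s with
        | zero => simp
        | add s s' h h' => simp only [TensorProduct.add_tmul, map_add, h, h']
        | tmul a b =>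
          simp only [LinearMap.rTensor_tmul, TensorProduct.assoc_tmul]
          generalize lM a = t
          induction t with
          | zero => simp
          | add s s' h h' => simp only [TensorProduct.add_tmul, map_add, h, h']
          | tmul c d => simp
      · generalize lM m = t
        induction t with
        | zero => simp
        | add s s' h h' => simp only [TensorProduct.add_tmul, map_add, h, h']
        | tmul a b => simp
  rw [key, show cotensorMap rM lN x = 0 from x.2]
  simp

end Coactions

section Comodules

variable (k : Type u) [Field k]

/-- Right comodules over a `k`-coalgebra `C`. -/
structure Comod (C : Type u) [AddCommGroup C] [Module k C] [Coalgebra k C] where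
  /-- the underlying vector space -/
  carrier : Type u
  [addCommGroup : AddCommGroup carrier]
  [module : Module k carrier]
  /-- the coaction `M → M ⊗ C` -/
  coact : carrier →ₗ[k] carrier ⊗[k] C
  isRightCoaction : IsRightCoaction coact

attribute [instance] Comod.addCommGroup Comod.module

/-- `(A, B)`-bicomodules: a left `A`-coaction and a right `B`-coaction that are compatible. -/
structure Bicomod (A : Type u) [AddCommGroup A] [Module k A] [Coalgebra k A]
    (B : Type u) [AddCommGroup B] [Module k B] [Coalgebra k B] where
  /-- the underlying vector space -/
  carrier : Type u
  [addCommGroup : AddCommGroup carrier]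
  [module : Module k carrier]
  /-- the left coaction `M → A ⊗ M` -/
  lcoact : carrier →ₗ[k] A ⊗[k] carrier
  /-- the right coaction `M → M ⊗ B` -/
  rcoact : carrier →ₗ[k] carrier ⊗[k] B
  isLeftCoaction : IsLeftCoaction lcoact
  isRightCoaction : IsRightCoaction rcoact
  commute : CoactionsCommute lcoact rcoact

attribute [instance] Bicomod.addCommGroup Bicomod.module

variable {k}
variable {A : Type u} [AddCommGroup A] [Module k A] [Coalgebra k A]
variable {B : Type u} [AddCommGroup B] [Module k B] [Coalgebra k B]
variable {A' : Type u} [AddCommGroup A'] [Module k A'] [Coalgebra k A']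
variable {B' : Type u} [AddCommGroup B'] [Module k B'] [Coalgebra k B']
variable {C : Type u} [AddCommGroup C] [Module k C] [Coalgebra k C]
variable {D : Type u} [AddCommGroup D] [Module k D] [Coalgebra k D]

/-! ### Bicomodules -/

namespace Bicomod

variable (k) in
/-- A coalgebra `C` as a `(C, C)`-bicomodule. -/
def regular (C : Type u) [AddCommGroup C] [Module k C] [Coalgebra k C] : Bicomod k C C where
  carrier := C
  lcoact := Coalgebra.comul
  rcoact := Coalgebra.comul
  isLeftCoaction := ⟨Coalgebra.coassoc_apply, Coalgebra.rTensor_counit_comul⟩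
  isRightCoaction := ⟨Coalgebra.coassoc_apply, Coalgebra.lTensor_counit_comul⟩
  commute := fun c => (Coalgebra.coassoc_apply c).symm

/-- An `(A, B)`-bicomodule as an `(A', B')`-bicomodule, via `f : A → A'` and `g : B → B'`. -/
def corestrict (f : A →ₗc[k] A') (g : B →ₗc[k] B') (X : Bicomod k A B) : Bicomod k A' B' where
  carrier := X.carrier
  lcoact := corestrictLeft f X.lcoact
  rcoact := corestrictRight g X.rcoact
  isLeftCoaction := X.isLeftCoaction.corestrict f
  isRightCoaction := X.isRightCoaction.corestrict g
  commute := X.commute.corestrict f g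

/-- The direct sum of two bicomodules. -/
def prod (X Y : Bicomod k A B) : Bicomod k A B where
  carrier := X.carrier × Y.carrier
  lcoact := prodLeft X.lcoact Y.lcoact
  rcoact := prodRight X.rcoact Y.rcoact
  isLeftCoaction := X.isLeftCoaction.prod Y.isLeftCoaction
  isRightCoaction := X.isRightCoaction.prod Y.isRightCoaction
  commute := X.commute.prod Y.commute

/-- The direct sum of `n` copies of a bicomodule. -/
def pow (X : Bicomod k A B) (n : ℕ) : Bicomod k A B where
  carrier := Fin n → X.carrier
  lcoact := powLeft n X.lcoact
  rcoact := powRight n X.rcoact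
  isLeftCoaction := X.isLeftCoaction.pow n
  isRightCoaction := X.isRightCoaction.pow n
  commute := X.commute.pow n

/-- The cotensor product `X □_B Y` of an `(A, B)`-bicomodule and a `(B, B')`-bicomodule: the
subspace `ker (r_X ⊗ 1 - 1 ⊗ l_Y)` of `X ⊗ Y`, with the restrictions of the left coaction
`l_X ⊗ 1` and of the right coaction `1 ⊗ r_Y`. -/
def cotensor (X : Bicomod k A B) (Y : Bicomod k B B') : Bicomod k A B' where
  carrier := cotensorSubmodule X.rcoact Y.lcoact
  lcoact := restrictLeft (tensorLeft Y.carrier X.lcoact) _ (cotensor_left_mem X.commute)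
  rcoact := restrictRight (tensorRight X.carrier Y.rcoact) _ (cotensor_right_mem Y.commute)
  isLeftCoaction := IsLeftCoaction.of_injective (restrictLeft_spec _ _ _)
    (Submodule.injective_subtype _) X.isLeftCoaction.tensor
  isRightCoaction := IsRightCoaction.of_injective (restrictRight_spec _ _ _)
    (Submodule.injective_subtype _) Y.isRightCoaction.tensor
  commute := CoactionsCommute.of_injective (restrictLeft_spec _ _ _) (restrictRight_spec _ _ _)
    (Submodule.injective_subtype _) (CoactionsCommute.tensor _ _)

/-- The underlying right comodule of a bicomodule. -/
def right (X : Bicomod k A B) : Comod k B where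
  carrier := X.carrier
  coact := X.rcoact
  isRightCoaction := X.isRightCoaction

/-- Isomorphism of bicomodules: a linear bijection that is left and right colinear. -/
def Isomorphic (X Y : Bicomod k A B) : Prop :=
  ∃ e : X.carrier ≃ₗ[k] Y.carrier,
    (∀ x, Y.lcoact (e x) = e.toLinearMap.lTensor A (X.lcoact x)) ∧
    (∀ x, Y.rcoact (e x) = e.toLinearMap.rTensor B (X.rcoact x))

/-- `X` is isomorphic to a direct summand of a finite direct sum of copies of `Y`. -/
def Divides (X Y : Bicomod k A B) : Prop :=
  ∃ (n : ℕ) (P : Bicomod k A B), Isomorphic (X.prod P) (Y.pow n)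

end Bicomod

/-! ### Right comodules -/

namespace Comod

variable (k) in
/-- A coalgebra `C` as a right comodule over itself. -/
def regular (C : Type u) [AddCommGroup C] [Module k C] [Coalgebra k C] : Comod k C where
  carrier := C
  coact := Coalgebra.comul
  isRightCoaction := ⟨Coalgebra.coassoc_apply, Coalgebra.lTensor_counit_comul⟩

/-- The direct sum of two comodules. -/
def prod (M N : Comod k C) : Comod k C where
  carrier := M.carrier × N.carrier
  coact := prodRight M.coact N.coact
  isRightCoaction := M.isRightCoaction.prod N.isRightCoaction

/-- The direct sum of `n` copies of a comodule. -/
def pow (M : Comod k C) (n : ℕ) : Comod k C where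
  carrier := Fin n → M.carrier
  coact := powRight n M.coact
  isRightCoaction := M.isRightCoaction.pow n

/-- The comodule `W ⊗ M` with coaction `1 ⊗ ρ_M`, for a vector space `W`. -/
def tensor (W : Type u) [AddCommGroup W] [Module k W] (M : Comod k C) : Comod k C where
  carrier := W ⊗[k] M.carrier
  coact := tensorRight W M.coact
  isRightCoaction := M.isRightCoaction.tensor

/-- The vector space `Com_C(M, N)` of comodule maps, i.e. linear maps `f` with
`ρ_N f = (f ⊗ 1) ρ_M`. -/
def Com (M N : Comod k C) : Submodule k (M.carrier →ₗ[k] N.carrier) where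
  carrier := {f | N.coact ∘ₗ f = f.rTensor C ∘ₗ M.coact}
  add_mem' {f g} hf hg := by
    simp only [Set.mem_ofPred_eq] at hf hg ⊢
    rw [LinearMap.comp_add, hf, hg, LinearMap.rTensor_add, LinearMap.add_comp]
  zero_mem' := by simp
  smul_mem' a f hf := by
    simp only [Set.mem_ofPred_eq] at hf ⊢
    rw [LinearMap.comp_smul, hf, LinearMap.rTensor_smul, LinearMap.smul_comp]

/-- The category `𝓜^C` of right `C`-comodules and comodule maps. -/
instance : Category (Comod k C) where
  Hom M N := Com M N
  id M := ⟨LinearMap.id, by simp [Com]⟩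
  comp {M N P} f g := ⟨g.1 ∘ₗ f.1, by
    have hf : N.coact ∘ₗ f.1 = f.1.rTensor C ∘ₗ M.coact := f.2
    have hg : P.coact ∘ₗ g.1 = g.1.rTensor C ∘ₗ N.coact := g.2
    change P.coact ∘ₗ (g.1 ∘ₗ f.1) = (g.1 ∘ₗ f.1).rTensor C ∘ₗ M.coact
    rw [← LinearMap.comp_assoc, hg, LinearMap.comp_assoc, hf, LinearMap.rTensor_comp,
      LinearMap.comp_assoc]⟩

instance : Preadditive (Comod k C) where
  homGroup M N := inferInstanceAs (AddCommGroup (Com M N))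
  add_comp _ _ _ f f' g := Subtype.ext (LinearMap.comp_add f.1 f'.1 g.1)
  comp_add _ _ _ f g g' := Subtype.ext (LinearMap.add_comp f.1 g'.1 g.1)

instance : Linear k (Comod k C) where
  homModule M N := inferInstanceAs (Module k (Com M N))
  smul_comp _ _ _ a f g := Subtype.ext (LinearMap.comp_smul g.1 a f.1)
  comp_smul _ _ _ f a g := Subtype.ext (LinearMap.smul_comp a g.1 f.1)

/-- `M` and `N` are similar: `M ⊕ P ≅ N^m` and `N ⊕ Q ≅ M^n` for some `m`, `n`, `P`, `Q`. -/
def Similar (M N : Comod k C) : Prop :=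
  ∃ (m n : ℕ) (P Q : Comod k C),
    Nonempty (M.prod P ≅ N.pow m) ∧ Nonempty (N.prod Q ≅ M.pow n)

/-- An ingenerator: `M ⊕ P ≅ C^m` and `C ⊕ Q ≅ M^n` for some `m`, `n`, `P`, `Q`. -/
def IsIngenerator (M : Comod k C) : Prop := Similar M (regular k C)

/-- `M` is quasi-finite: `Com_C(Y, M)` is finite dimensional for every finite dimensional `Y`. -/
def IsQuasiFinite (M : Comod k C) : Prop :=
  ∀ Y : Comod k C, FiniteDimensional k Y.carrier → FiniteDimensional k (Com Y M)

/-- The coalgebra `E`, with `θ : M → E ⊗ M`, is the coendomorphism coalgebra `e_{-C}(M)` of `M`.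
The first two fields say that `(E, θ)` is the value at `M`, together with the unit, of the left
adjoint (co-hom functor) of `- ⊗ M : 𝓜_k → 𝓜^C`; the last two fix the coalgebra structure of
`E`, by saying that `θ` makes `M` a left `E`-comodule. -/
structure IsCoendomorphismCoalgebra (M : Comod k C) (E : Type u) [AddCommGroup E] [Module k E]
    [Coalgebra k E] (θ : M.carrier →ₗ[k] E ⊗[k] M.carrier) : Prop where
  colinear : θ ∈ Com M (M.tensor E)
  universal : ∀ (W : Type u) [AddCommGroup W] [Module k W],
    ∀ f ∈ Com M (M.tensor W), ∃! g : E →ₗ[k] W, g.rTensor M.carrier ∘ₗ θ = f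
  isLeftCoaction : IsLeftCoaction θ

end Comod

/-! ### Strong equivalence, codepth two -/

variable (k) in
/-- `A` and `B` are strongly equivalent: there are inverse (`k`-linear) equivalences
`F : 𝓜^A ⇄ 𝓜^B : G` such that `F(A)` and `G(B)` are ingenerators. -/
def StronglyEquivalent (A : Type u) [AddCommGroup A] [Module k A] [Coalgebra k A]
    (B : Type u) [AddCommGroup B] [Module k B] [Coalgebra k B] : Prop :=
  ∃ F : Comod k A ≌ Comod k B,
    F.functor.Additive ∧ F.functor.Linear k ∧
    (F.functor.obj (Comod.regular k A)).IsIngenerator ∧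
    (F.inverse.obj (Comod.regular k B)).IsIngenerator

/-- The `(C, C)`-bicomodule `C □_D C` of a coalgebra homomorphism `φ : C → D`: the left factor
is a `(C, D)`-bicomodule and the right factor is a `(D, C)`-bicomodule via `φ`. -/
def cotensorSquare (φ : C →ₗc[k] D) : Bicomod k C C :=
  ((Bicomod.regular k C).corestrict (CoalgHom.id k C) φ).cotensor
    ((Bicomod.regular k C).corestrict φ (CoalgHom.id k C))

/-- `φ : C → D` is left codepth two: `C □_D C` is isomorphic to a direct summand of a finite
direct sum of copies of `C`, as `(D, C)`-bicomodules. -/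
def IsLeftCodepthTwo (φ : C →ₗc[k] D) : Prop :=
  ((cotensorSquare φ).corestrict φ (CoalgHom.id k C)).Divides
    ((Bicomod.regular k C).corestrict φ (CoalgHom.id k C))

/-- `φ : C → D` is right codepth two: `C □_D C` is isomorphic to a direct summand of a finite
direct sum of copies of `C`, as `(C, D)`-bicomodules. -/
def IsRightCodepthTwo (φ : C →ₗc[k] D) : Prop :=
  ((cotensorSquare φ).corestrict (CoalgHom.id k C) φ).Divides
    ((Bicomod.regular k C).corestrict (CoalgHom.id k C) φ)

/-- The right `D`-comodule `C_D`, with coaction `(1 ⊗ φ) Δ`. -/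
def regularOver (φ : C →ₗc[k] D) : Comod k D :=
  ((Bicomod.regular k C).corestrict (CoalgHom.id k C) φ).right

/-- The right `D`-comodule `(C □_D C)_D`. -/
def cotensorSquareOver (φ : C →ₗc[k] D) : Comod k D :=
  ((cotensorSquare φ).corestrict (CoalgHom.id k C) φ).right

end Comodules

end

end CoalgebraTheory

/-!
Write `M = C_D` and `N = (C □_D C)_D`. The comultiplication `C → C □_D C` is split by `ε ⊗ 1`, so
`M` is a direct summand of `N` (`regularOver_isSummandOfPow`). Forgetting the left coaction, either
codepth two condition makes `N` a direct summand of some `M^n`. Hence there are comodule maps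
`p i : M → N`, `q i : N → M` with `∑ q i p i = 1` and `r j : N → M`, `s j : M → N` with
`∑ s j r j = 1`. The theorem follows from two facts about right comodules over any coalgebra.

*Existence.* A quasi-finite `M` has a coendomorphism coalgebra: it is the space `E` of the
functionals `f ↦ ∑ ξ_i (f m_i)` on the endomorphisms of `M`. Every `m : M` lies in a finite
dimensional subcomodule (`exists_finiteDimensional_hom`), so quasi-finiteness makes the space of
all `f m` finite dimensional; therefore `ξ ↦ (f ↦ ξ (f m))` is represented by a tensor
`θ m ∈ E ⊗ M`, and `θ` is the universal coaction. Its universal property provides the coalgebra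
structure of `E` (`exists_coalgebra_of_universal`).

*Strong equivalence.* Let `E` and `F` be coendomorphism coalgebras of `M` and `N`. Maps `f : M → N`
and `r : N → M` induce a linear map `γ(f, r) : E → F`, the transfer, with
`(γ(f, r) ⊗ 1) θ_M = (1 ⊗ r) θ_N f`; it is dual to `b ↦ r b f`. Transfers compose as
`γ(f', r') γ(f, r) = γ(f' f, r r')`, and the matrix `γ j l = γ(s j, r l)` satisfies
`Δ (γ j l) = ∑ i, (γ j i ⊗ γ i l) Δ`. For a right `E`-comodule `X` this matrix defines on `X^n` a
coassociative map to `X^n ⊗ F`. It lacks the counit law, but restricts to a comodule structure on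
the image of the idempotent `(1 ⊗ ε)`, the *corner*. This gives a functor `𝓜^E ⥤ 𝓜^F`, a concrete
form of the cotensor product with the co-hom space of `N` and `M`. The functor in the other
direction uses the matrix of the `γ(q i, p l)`, and the unit is
`x ↦ (x · (q i s j))_{ij}`, where an endomorphism acts on `X` through the corresponding functional
on `E`; its inverse is `(x_{ij}) ↦ ∑ x_{ij} · (r j p i)` (`MatrixUnit`, `matrixUnit`). Finally,
transfers also exhibit the image of `E` and `F` as summands of powers of each other
(`matrixComod_isSummandOfPow`, `isSummandOfPow_matrixComod`).
-/

namespace CoalgebraTheory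

noncomputable section

/-! ### The action of the dual algebra on a comodule -/

section DualAction

variable {k : Type u} [Field k]
variable {A : Type u} [AddCommGroup A] [Module k A] [Coalgebra k A]
variable {V : Type u} [AddCommGroup V] [Module k V]

/-- The operator `x ↦ (1 ⊗ a) r(x)` by which a functional `a` on `A` acts on a right
`A`-comodule. -/
def dualAct (r : V →ₗ[k] V ⊗[k] A) (a : A →ₗ[k] k) : V →ₗ[k] V :=
  (TensorProduct.rid k V).toLinearMap ∘ₗ a.lTensor V ∘ₗ r

/-- The operator `x ↦ (a ⊗ 1) Δ(x)` on the coalgebra `A`. -/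
def dualActLeft (a : A →ₗ[k] k) : A →ₗ[k] A :=
  (TensorProduct.lid k A).toLinearMap ∘ₗ a.rTensor A ∘ₗ Coalgebra.comul

theorem dualAct_apply (r : V →ₗ[k] V ⊗[k] A) (a : A →ₗ[k] k) (x : V) :
    dualAct r a x = TensorProduct.rid k V (a.lTensor V (r x)) := rfl

variable {r : V →ₗ[k] V ⊗[k] A}

theorem IsRightCoaction.dualAct_counit (hr : IsRightCoaction r) (x : V) :
    dualAct r Coalgebra.counit x = x := by
  rw [dualAct_apply, hr.counit]; simp

/-- The coassociativity law after applying linear maps to both coalgebra factors. -/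
theorem IsRightCoaction.map_coassoc (hr : IsRightCoaction r) {W W' : Type u} [AddCommGroup W]
    [Module k W] [AddCommGroup W'] [Module k W'] (g : A →ₗ[k] W) (h : A →ₗ[k] W') (x : V) :
    TensorProduct.assoc k V W W' ((g.lTensor V ∘ₗ r).rTensor W' (h.lTensor V (r x))) =
      (TensorProduct.map g h ∘ₗ Coalgebra.comul).lTensor V (r x) := by
  have e : (TensorProduct.assoc k V W W').toLinearMap ∘ₗ (g.lTensor V).rTensor W' ∘ₗ
      h.lTensor (V ⊗[k] A) =
      (TensorProduct.map g h).lTensor V ∘ₗ (TensorProduct.assoc k V A A).toLinearMap := by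
    ext; simp
  have e1 := LinearMap.congr_fun e (r.rTensor A (r x))
  simp only [LinearMap.comp_apply, LinearEquiv.coe_coe] at e1
  rw [LinearMap.lTensor_comp_apply, ← hr.coassoc, ← e1, LinearMap.rTensor_comp_apply]
  congr 2
  rw [← LinearMap.comp_apply, ← LinearMap.comp_apply (h.lTensor (V ⊗[k] A)),
    LinearMap.lTensor_comp_rTensor, LinearMap.rTensor_comp_lTensor]

/-- The coaction of `(1 ⊗ a) r(x)`, expressed through the action of `a` on the coalgebra. -/
theorem IsRightCoaction.coact_dualAct (hr : IsRightCoaction r) {W : Type u} [AddCommGroup W]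
    [Module k W] (g : A →ₗ[k] W) (a : A →ₗ[k] k) (x : V) :
    g.lTensor V (r (dualAct r a x)) = (g ∘ₗ dualAct Coalgebra.comul a).lTensor V (r x) := by
  have e : ∀ t : V ⊗[k] A, (g.lTensor V ∘ₗ r) (TensorProduct.rid k V (a.lTensor V t)) =
      (TensorProduct.rid k W).toLinearMap.lTensor V
        (TensorProduct.assoc k V W k ((g.lTensor V ∘ₗ r).rTensor k (a.lTensor V t))) := by
    intro t
    induction t with
    | zero => simp
    | add s t hs ht => simp only [map_add, hs, ht]
    | tmul v c =>
      simp only [LinearMap.lTensor_tmul, TensorProduct.rid_tmul, LinearMap.rTensor_tmul, map_smul]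
      generalize (g.lTensor V ∘ₗ r) v = s
      induction s with
      | zero => simp
      | add s t hs ht => simp only [smul_add, TensorProduct.add_tmul, map_add, hs, ht]
      | tmul v c => simp
  rw [dualAct_apply]
  rw [← LinearMap.comp_apply, e, hr.map_coassoc, ← LinearMap.lTensor_comp_apply]
  congr 2
  have : (TensorProduct.rid k W).toLinearMap ∘ₗ TensorProduct.map g a =
      g ∘ₗ (TensorProduct.rid k A).toLinearMap ∘ₗ a.lTensor A := by
    ext; simp
  rw [← LinearMap.comp_assoc, this]
  rfl

theorem IsRightCoaction.dualAct_dualAct (hr : IsRightCoaction r) (a b : A →ₗ[k] k) (x : V) :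
    dualAct r a (dualAct r b x) = dualAct r (a ∘ₗ dualAct Coalgebra.comul b) x := by
  rw [dualAct_apply, hr.coact_dualAct]; rfl

theorem IsRightCoaction.rTensor_dualAct (hr : IsRightCoaction r) (a : A →ₗ[k] k) (x : V) :
    (dualAct r a).rTensor A (r x) = (dualActLeft a).lTensor V (r x) := by
  have h := hr.map_coassoc a LinearMap.id x
  rw [LinearMap.lTensor_id, LinearMap.id_apply] at h
  have e : (dualAct r a).rTensor A (r x) = (TensorProduct.lid k A).toLinearMap.lTensor V
      (TensorProduct.assoc k V k A ((a.lTensor V ∘ₗ r).rTensor A (r x))) := by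
    rw [dualAct, LinearMap.rTensor_comp_apply]
    generalize (a.lTensor V ∘ₗ r).rTensor A (r x) = t
    have : (TensorProduct.rid k V).toLinearMap.rTensor A =
      (TensorProduct.lid k A).toLinearMap.lTensor V ∘ₗ
        (TensorProduct.assoc k V k A).toLinearMap := by
      ext; simp
    exact LinearMap.congr_fun this t
  rw [e, h, ← LinearMap.lTensor_comp_apply]
  rfl

theorem dualAct_sum {V : Type u} {ι : Type*} [AddCommGroup V] [Module k V] (r : V →ₗ[k] V ⊗[k] A)
    (s : Finset ι) (a : ι → A →ₗ[k] k) (x : V) :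
    dualAct r (∑ i ∈ s, a i) x = ∑ i ∈ s, dualAct r (a i) x := by
  have : (∑ i ∈ s, a i).lTensor V = ∑ i ∈ s, (a i).lTensor V :=
    map_sum (LinearMap.lTensorHom V) _ _
  simp only [dualAct_apply, this, LinearMap.sum_apply, map_sum]

theorem lTensor_sum_apply {V W ι : Type*} [AddCommGroup V] [Module k V] [AddCommGroup W]
    [Module k W] (s : Finset ι) (a : ι → A →ₗ[k] W) (x : V ⊗[k] A) :
    (∑ i ∈ s, a i).lTensor V x = ∑ i ∈ s, (a i).lTensor V x := by
  have : (∑ i ∈ s, a i).lTensor V = ∑ i ∈ s, (a i).lTensor V :=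
    map_sum (LinearMap.lTensorHom V) _ _
  rw [this, LinearMap.sum_apply]

end DualAction

/-! ### Coactions without counit and their corners -/

section Corner

variable {k : Type u} [Field k]
variable {B : Type u} [AddCommGroup B] [Module k B] [Coalgebra k B]
variable {V : Type u} [AddCommGroup V] [Module k V]
variable {V' : Type u} [AddCommGroup V'] [Module k V']

/-- Coassociativity of `r : V → V ⊗ B`, without the counit law. -/
def IsCoassociative (r : V →ₗ[k] V ⊗[k] B) : Prop :=
  ∀ m, TensorProduct.assoc k V B B (r.rTensor B (r m)) =
    (Coalgebra.comul (R := k) (A := B)).lTensor V (r m)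

/-- The idempotent operator `(1 ⊗ ε) r` attached to a coassociative `r : V → V ⊗ B`. -/
def counitProj (r : V →ₗ[k] V ⊗[k] B) : V →ₗ[k] V := dualAct r Coalgebra.counit

theorem IsCoassociative.rTensor_counitProj {r : V →ₗ[k] V ⊗[k] B} (hr : IsCoassociative r)
    (x : V) : (counitProj r).rTensor B (r x) = r x := by
  have e : (counitProj r).rTensor B = (TensorProduct.lid k B).toLinearMap.lTensor V ∘ₗ
      ((Coalgebra.counit (R := k) (A := B)).rTensor B).lTensor V ∘ₗ
        (TensorProduct.assoc k V B B).toLinearMap ∘ₗ r.rTensor B := by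
    rw [counitProj, dualAct, LinearMap.rTensor_comp, LinearMap.rTensor_comp]
    simp only [← LinearMap.comp_assoc]
    congr 1
    ext; simp [TensorProduct.smul_tmul']
  rw [e]
  simp only [LinearMap.comp_apply, LinearEquiv.coe_coe, hr x]
  rw [← LinearMap.lTensor_comp_apply, ← LinearMap.lTensor_comp_apply, LinearMap.comp_assoc,
    Coalgebra.rTensor_counit_comp_comul]
  have : (TensorProduct.lid k B).toLinearMap ∘ₗ TensorProduct.mk k k B 1 = LinearMap.id := by
    ext; simp
  rw [this, LinearMap.lTensor_id, LinearMap.id_apply]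

theorem counitProj_colinear {r : V →ₗ[k] V ⊗[k] B} {r' : V' →ₗ[k] V' ⊗[k] B}
    {f : V →ₗ[k] V'} (h : r' ∘ₗ f = f.rTensor B ∘ₗ r) (x : V) :
    counitProj r' (f x) = f (counitProj r x) := by
  rw [counitProj, counitProj, dualAct_apply, dualAct_apply, nat_right _ h]
  generalize (Coalgebra.counit (R := k) (A := B)).lTensor V (r x) = t
  have : (TensorProduct.rid k V').toLinearMap ∘ₗ f.rTensor k =
    f ∘ₗ (TensorProduct.rid k V).toLinearMap := by ext; simp
  exact LinearMap.congr_fun this t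

theorem IsCoassociative.counitProj_idem {r : V →ₗ[k] V ⊗[k] B} (hr : IsCoassociative r)
    (x : V) : counitProj r (counitProj r x) = counitProj r x := by
  have e : ∀ t : V ⊗[k] B, counitProj r (TensorProduct.rid k V (Coalgebra.counit.lTensor V t)) =
      TensorProduct.rid k V (Coalgebra.counit.lTensor V ((counitProj r).rTensor B t)) := by
    intro t
    induction t with
    | zero => simp
    | add s t hs ht => simp only [map_add, hs, ht]
    | tmul v c => simp
  exact (e (r x)).trans (by rw [hr.rTensor_counitProj]; rfl)

/-- The coaction of `B` on the image of `(1 ⊗ ε) r`. -/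
def cornerCoact (r : V →ₗ[k] V ⊗[k] B) :
    LinearMap.range (counitProj r) →ₗ[k] LinearMap.range (counitProj r) ⊗[k] B :=
  (counitProj r).rangeRestrict.rTensor B ∘ₗ r ∘ₗ (LinearMap.range (counitProj r)).subtype

/-- The corner is stable under `r`, because `r = ((1 ⊗ ε) r ⊗ 1) r`. -/
theorem IsCoassociative.cornerCoact_spec {r : V →ₗ[k] V ⊗[k] B} (hr : IsCoassociative r) :
    r ∘ₗ (LinearMap.range (counitProj r)).subtype =
      (LinearMap.range (counitProj r)).subtype.rTensor B ∘ₗ cornerCoact r := by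
  rw [cornerCoact, ← LinearMap.comp_assoc, ← LinearMap.rTensor_comp,
    LinearMap.subtype_comp_codRestrict]
  ext x
  exact (hr.rTensor_counitProj x.1).symm

theorem IsCoassociative.counitProj_of_mem {r : V →ₗ[k] V ⊗[k] B} (hr : IsCoassociative r)
    {x : V} (hx : x ∈ LinearMap.range (counitProj r)) : counitProj r x = x := by
  obtain ⟨y, rfl⟩ := hx
  exact hr.counitProj_idem y

theorem IsCoassociative.cornerCoact_comp {r : V →ₗ[k] V ⊗[k] B} (hr : IsCoassociative r)
    {rM : V' →ₗ[k] V' ⊗[k] B} {g : V' →ₗ[k] LinearMap.range (counitProj r)}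
    (h : r ∘ₗ (LinearMap.range (counitProj r)).subtype ∘ₗ g =
      ((LinearMap.range (counitProj r)).subtype ∘ₗ g).rTensor B ∘ₗ rM) :
    cornerCoact r ∘ₗ g = g.rTensor B ∘ₗ rM := by
  ext x : 1
  apply Module.Flat.rTensor_preserves_injective_linearMap (M := B) _
    (Submodule.injective_subtype (LinearMap.range (counitProj r)))
  rw [LinearMap.comp_apply, LinearMap.comp_apply, ← LinearMap.rTensor_comp_apply]
  exact (LinearMap.congr_fun hr.cornerCoact_spec _).symm.trans (LinearMap.congr_fun h x)

theorem IsCoassociative.comp_subtype_colinear {r : V →ₗ[k] V ⊗[k] B} (hr : IsCoassociative r)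
    {rM : V' →ₗ[k] V' ⊗[k] B} {f : V →ₗ[k] V'} (h : rM ∘ₗ f = f.rTensor B ∘ₗ r) :
    rM ∘ₗ (f ∘ₗ (LinearMap.range (counitProj r)).subtype) =
      (f ∘ₗ (LinearMap.range (counitProj r)).subtype).rTensor B ∘ₗ cornerCoact r := by
  rw [← LinearMap.comp_assoc, h, LinearMap.comp_assoc, hr.cornerCoact_spec,
    LinearMap.rTensor_comp, LinearMap.comp_assoc]

/-- A coassociative `r : V → V ⊗ B` restricts to a counital coaction on the image of the
idempotent `(1 ⊗ ε) r`. -/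
def corner (r : V →ₗ[k] V ⊗[k] B) (hr : IsCoassociative r) : Comod k B where
  carrier := LinearMap.range (counitProj r)
  coact := cornerCoact r
  isRightCoaction :=
    { coassoc := fun n => by
        apply Module.Flat.rTensor_preserves_injective_linearMap (M := B ⊗[k] B) _
          (Submodule.injective_subtype _)
        rw [← nat_right_assoc hr.cornerCoact_spec, ← nat_right _ hr.cornerCoact_spec]
        exact hr _
      counit := fun n => by
        apply Module.Flat.rTensor_preserves_injective_linearMap (M := k) _
          (Submodule.injective_subtype _)
        rw [← nat_right _ hr.cornerCoact_spec]
        apply (TensorProduct.rid k V).injective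
        refine (hr.counitProj_of_mem n.2).trans ?_
        simp }

end Corner

namespace Comod

variable {k : Type u} [Field k]
variable {B : Type u} [AddCommGroup B] [Module k B] [Coalgebra k B]
variable {V : Type u} [AddCommGroup V] [Module k V]
variable {M N P : Comod k B}

/-- The linear map underlying a morphism of comodules. -/
def lin : (M ⟶ N) →ₗ[k] (M.carrier →ₗ[k] N.carrier) := (Com M N).subtype

theorem lin_colinear (f : M ⟶ N) : N.coact ∘ₗ lin f = (lin f).rTensor B ∘ₗ M.coact := f.2

theorem lin_colinear_apply (f : M ⟶ N) (x : M.carrier) :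
    N.coact (lin f x) = (lin f).rTensor B (M.coact x) := LinearMap.congr_fun f.2 x

/-- A colinear map as a morphism of comodules. -/
def homMk (f : M.carrier →ₗ[k] N.carrier) (h : N.coact ∘ₗ f = f.rTensor B ∘ₗ M.coact) :
    M ⟶ N := (⟨f, h⟩ : Com M N)

@[simp] theorem lin_homMk (f : M.carrier →ₗ[k] N.carrier)
    (h : N.coact ∘ₗ f = f.rTensor B ∘ₗ M.coact) : lin (homMk f h) = f := rfl

@[simp] theorem lin_comp (f : M ⟶ N) (g : N ⟶ P) : lin (f ≫ g) = lin g ∘ₗ lin f := rfl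

@[simp] theorem lin_id : lin (𝟙 M) = LinearMap.id := rfl

theorem lin_sum_apply {X Y : Comod k B} {ι : Type*} (S : Finset ι) (f : ι → (X ⟶ Y))
    (x : X.carrier) : lin (∑ i ∈ S, f i) x = ∑ i ∈ S, lin (f i) x := by
  rw [map_sum, LinearMap.sum_apply]

theorem hom_ext {f g : M ⟶ N} (h : ∀ x, lin f x = lin g x) : f = g :=
  Subtype.ext (LinearMap.ext h)

/-- A bijective colinear map is an isomorphism of comodules. -/
def isoOfInverse (f : M ⟶ N) (g : N.carrier →ₗ[k] M.carrier) (h₁ : ∀ x, g (lin f x) = x)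
    (h₂ : ∀ y, lin f (g y) = y) : M ≅ N where
  hom := f
  inv := homMk g (by
    ext y
    obtain ⟨x, rfl⟩ : ∃ x, lin f x = y := ⟨g y, h₂ y⟩
    have e : g ∘ₗ lin f = LinearMap.id := LinearMap.ext h₁
    simp only [LinearMap.comp_apply, lin_colinear_apply, h₁]
    rw [← LinearMap.rTensor_comp_apply, e]
    simp)
  hom_inv_id := hom_ext h₁
  inv_hom_id := hom_ext h₂

variable {r : V →ₗ[k] V ⊗[k] B} (hr : IsCoassociative r)

/-- A linear map into `V`, compatible with `r`, takes values in the corner of `r`. -/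
def cornerLift (f : M.carrier →ₗ[k] V) (h : r ∘ₗ f = f.rTensor B ∘ₗ M.coact) :
    M ⟶ corner r hr :=
  homMk (f.codRestrict (LinearMap.range (counitProj r)) (fun x => LinearMap.mem_range.2 ⟨f x, by
    rw [counitProj_colinear h, counitProj, M.isRightCoaction.dualAct_counit]⟩))
    (hr.cornerCoact_comp (by rw [LinearMap.subtype_comp_codRestrict, h]))

/-- The inclusion of the corner of `r` into the space on which `r` is defined. -/
def cornerIncl : (corner r hr).carrier →ₗ[k] V := (LinearMap.range (counitProj r)).subtype

theorem cornerIncl_injective : Function.Injective (cornerIncl hr) :=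
  Submodule.injective_subtype _

theorem cornerIncl_colinear : r ∘ₗ cornerIncl hr =
    (cornerIncl hr).rTensor B ∘ₗ (corner r hr).coact := hr.cornerCoact_spec

theorem counitProj_cornerIncl (x : (corner r hr).carrier) :
    counitProj r (cornerIncl hr x) = cornerIncl hr x := hr.counitProj_of_mem x.2

/-- A linear map out of `V`, compatible with `r`, restricts to a colinear map on the corner. -/
def cornerDesc (f : V →ₗ[k] M.carrier) (h : M.coact ∘ₗ f = f.rTensor B ∘ₗ r) :
    corner r hr ⟶ M :=
  homMk (f ∘ₗ (LinearMap.range (counitProj r)).subtype) (hr.comp_subtype_colinear h)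

end Comod

/-! ### Change of coalgebra along a comultiplicative matrix -/

section Matrix

variable {k : Type u} [Field k]
variable {A : Type u} [AddCommGroup A] [Module k A] [Coalgebra k A]
variable {B : Type u} [AddCommGroup B] [Module k B] [Coalgebra k B]
variable {V : Type u} [AddCommGroup V] [Module k V]
variable {W : Type u} [AddCommGroup W] [Module k W]
variable {n m : ℕ}

theorem pi_rTensor_ext {t t' : (Fin n → V) ⊗[k] W}
    (h : ∀ j, (LinearMap.proj (R := k) (φ := fun _ : Fin n => V) j).rTensor W t =
      (LinearMap.proj (R := k) (φ := fun _ : Fin n => V) j).rTensor W t') : t = t' := by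
  have e : ∀ s : (Fin n → V) ⊗[k] W, s = ∑ j, (LinearMap.single k (fun _ => V) j).rTensor W
      ((LinearMap.proj (R := k) (φ := fun _ : Fin n => V) j).rTensor W s) := by
    intro s
    induction s with
    | zero => simp
    | add s t hs ht => simp only [map_add, Finset.sum_add_distrib, ← hs, ← ht]
    | tmul x w =>
      simp only [LinearMap.rTensor_tmul, LinearMap.proj_apply, ← TensorProduct.sum_tmul]
      rw [← pow_decomp]
  rw [e t, e t']
  simp only [h]

/-- A square matrix of linear maps `γ j l : A → B` is comultiplicative if
`Δ (γ j l) = ∑ i, (γ j i ⊗ γ i l) Δ`; dually, it is a (possibly non-unital) homomorphism from the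
algebra `B^*` to matrices over `A^*`. -/
def IsComultiplicative (γ : Fin n → Fin n → (A →ₗ[k] B)) : Prop :=
  ∀ j l, Coalgebra.comul ∘ₗ γ j l =
    ∑ i, TensorProduct.map (γ j i) (γ i l) ∘ₗ Coalgebra.comul

/-- The map `V^n → V^n ⊗ B`, `x ↦ (∑ l, (1 ⊗ γ j l) r(x_l))_j`. -/
def matrixCoact (γ : Fin n → Fin n → (A →ₗ[k] B)) (r : V →ₗ[k] V ⊗[k] A) :
    (Fin n → V) →ₗ[k] (Fin n → V) ⊗[k] B :=
  ∑ j, (LinearMap.single k (fun _ => V) j).rTensor B ∘ₗ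
    ∑ l, (γ j l).lTensor V ∘ₗ r ∘ₗ LinearMap.proj l

theorem proj_matrixCoact (γ : Fin n → Fin n → (A →ₗ[k] B)) (r : V →ₗ[k] V ⊗[k] A) (j : Fin n) :
    (LinearMap.proj (R := k) (φ := fun _ : Fin n => V) j).rTensor B ∘ₗ matrixCoact γ r =
      ∑ l, (γ j l).lTensor V ∘ₗ r ∘ₗ LinearMap.proj l := by
  have e : ∀ i, (LinearMap.proj (R := k) (φ := fun _ : Fin n => V) j).rTensor B ∘ₗ
      (LinearMap.single k (fun _ => V) i).rTensor B = if i = j then LinearMap.id else 0 := by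
    intro i
    rw [← LinearMap.rTensor_comp]
    split_ifs with h
    · rw [h, LinearMap.proj_comp_single_same, LinearMap.rTensor_id]
    · rw [LinearMap.proj_comp_single_ne _ _ _ _ (Ne.symm h), LinearMap.rTensor_zero]
  refine LinearMap.ext fun x => ?_
  rw [matrixCoact, LinearMap.comp_apply, LinearMap.sum_apply, map_sum, Finset.sum_eq_single j]
  · rw [LinearMap.comp_apply, ← LinearMap.comp_apply, e, if_pos rfl, LinearMap.id_apply]
  · intro i _ hi
    rw [LinearMap.comp_apply, ← LinearMap.comp_apply, e, if_neg hi, LinearMap.zero_apply]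
  · simp

theorem proj_matrixCoact_apply (γ : Fin n → Fin n → (A →ₗ[k] B)) (r : V →ₗ[k] V ⊗[k] A)
    (j : Fin n) (x : Fin n → V) :
    (LinearMap.proj (R := k) (φ := fun _ : Fin n => V) j).rTensor B (matrixCoact γ r x) =
      ∑ l, (γ j l).lTensor V (r (x l)) := by
  have h := LinearMap.congr_fun (proj_matrixCoact γ r j) x
  simpa [LinearMap.sum_apply] using h

/-- Comultiplicativity of the matrix is what makes `matrixCoact` coassociative; the counit law fails
unless the matrix of the `ε (γ j l)` is the identity. -/
theorem IsComultiplicative.isCoassociative {γ : Fin n → Fin n → (A →ₗ[k] B)}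
    (hγ : IsComultiplicative γ) {r : V →ₗ[k] V ⊗[k] A} (hr : IsRightCoaction r) :
    IsCoassociative (matrixCoact γ r) := by
  intro x
  apply pi_rTensor_ext
  intro j
  have e : ∀ t : ((Fin n → V) ⊗[k] B) ⊗[k] B,
      (LinearMap.proj (R := k) (φ := fun _ : Fin n => V) j).rTensor (B ⊗[k] B)
        (TensorProduct.assoc k _ B B t) = TensorProduct.assoc k V B B
          (((LinearMap.proj (R := k) (φ := fun _ : Fin n => V) j).rTensor B).rTensor B t) := by
    have : (LinearMap.proj (R := k) (φ := fun _ : Fin n => V) j).rTensor (B ⊗[k] B) ∘ₗ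
        (TensorProduct.assoc k _ B B).toLinearMap = (TensorProduct.assoc k V B B).toLinearMap ∘ₗ
          ((LinearMap.proj (R := k) (φ := fun _ : Fin n => V) j).rTensor B).rTensor B := by
      apply TensorProduct.ext_threefold
      intros
      simp
    exact LinearMap.congr_fun this
  have e2 : (LinearMap.proj (R := k) (φ := fun _ : Fin n => V) j).rTensor (B ⊗[k] B)
      ((Coalgebra.comul (R := k) (A := B)).lTensor _ (matrixCoact γ r x)) =
      (Coalgebra.comul (R := k) (A := B)).lTensor V
        ((LinearMap.proj (R := k) (φ := fun _ : Fin n => V) j).rTensor B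
          (matrixCoact γ r x)) := by
    rw [← LinearMap.comp_apply, ← LinearMap.comp_apply (LinearMap.lTensor V _),
      LinearMap.lTensor_comp_rTensor, LinearMap.rTensor_comp_lTensor]
  rw [e, e2, ← LinearMap.rTensor_comp_apply, proj_matrixCoact, proj_matrixCoact_apply]
  have e3 : ∀ i, ((γ j i).lTensor V ∘ₗ r ∘ₗ LinearMap.proj i).rTensor B (matrixCoact γ r x) =
      ∑ l, ((γ j i).lTensor V ∘ₗ r).rTensor B ((γ i l).lTensor V (r (x l))) := by
    intro i
    rw [← LinearMap.comp_assoc, LinearMap.rTensor_comp_apply, proj_matrixCoact_apply, map_sum]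
  have e4 : (∑ i, (γ j i).lTensor V ∘ₗ r ∘ₗ LinearMap.proj (R := k)
      (φ := fun _ : Fin n => V) i).rTensor B = ∑ i, ((γ j i).lTensor V ∘ₗ r ∘ₗ
        LinearMap.proj i).rTensor B := map_sum (LinearMap.rTensorHom B) _ _
  rw [e4, LinearMap.sum_apply]
  simp only [e3, map_sum, hr.map_coassoc]
  rw [Finset.sum_comm]
  refine Finset.sum_congr rfl fun l _ => ?_
  rw [← LinearMap.lTensor_comp_apply, hγ j l, ← LinearMap.sum_apply]
  congr 1
  exact (map_sum (LinearMap.lTensorHom V) _ _).symm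

theorem counitProj_matrixCoact (γ : Fin n → Fin n → (A →ₗ[k] B)) (r : V →ₗ[k] V ⊗[k] A)
    (x : Fin n → V) (j : Fin n) :
    counitProj (matrixCoact γ r) x j = ∑ l, dualAct r (Coalgebra.counit ∘ₗ γ j l) (x l) := by
  have e : ∀ t : (Fin n → V) ⊗[k] B, TensorProduct.rid k (Fin n → V)
      (Coalgebra.counit.lTensor _ t) j = TensorProduct.rid k V (Coalgebra.counit.lTensor V
        ((LinearMap.proj (R := k) (φ := fun _ : Fin n => V) j).rTensor B t)) := by
    intro t
    induction t with
    | zero => simp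
    | add s t hs ht => simp only [map_add, Pi.add_apply, hs, ht]
    | tmul v c => simp
  rw [counitProj, dualAct_apply, e, proj_matrixCoact_apply, map_sum, map_sum]
  simp only [dualAct_apply, LinearMap.lTensor_comp_apply]

theorem matrixCoact_compLeft (γ : Fin n → Fin n → (A →ₗ[k] B)) {r : V →ₗ[k] V ⊗[k] A}
    {r' : W →ₗ[k] W ⊗[k] A} {f : V →ₗ[k] W} (h : r' ∘ₗ f = f.rTensor A ∘ₗ r) :
    matrixCoact γ r' ∘ₗ f.compLeft (Fin n) =
      (f.compLeft (Fin n)).rTensor B ∘ₗ matrixCoact γ r := by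
  refine LinearMap.ext fun x => ?_
  apply pi_rTensor_ext
  intro j
  rw [LinearMap.comp_apply, LinearMap.comp_apply, proj_matrixCoact_apply,
    ← LinearMap.rTensor_comp_apply]
  have e : (LinearMap.proj (R := k) (φ := fun _ : Fin n => W) j) ∘ₗ f.compLeft (Fin n) =
    f ∘ₗ LinearMap.proj (R := k) (φ := fun _ : Fin n => V) j := rfl
  rw [e, LinearMap.rTensor_comp_apply, proj_matrixCoact_apply, map_sum]
  exact Finset.sum_congr rfl fun l _ => nat_right _ h _

end Matrix

namespace Comod

variable {k : Type u} [Field k]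
variable {A : Type u} [AddCommGroup A] [Module k A] [Coalgebra k A]
variable {B : Type u} [AddCommGroup B] [Module k B] [Coalgebra k B]
variable {n m : ℕ}

section

variable {γ : Fin n → Fin n → (A →ₗ[k] B)} (hγ : IsComultiplicative γ)

/-- The right `B`-comodule obtained from the right `A`-comodule `X` and a comultiplicative matrix
`γ`: the corner of the coaction `x ↦ (∑ l, (1 ⊗ γ j l) r(x_l))_j` on `X^n`. -/
def matrixComod (X : Comod k A) : Comod k B :=
  corner (matrixCoact γ X.coact) (hγ.isCoassociative X.isRightCoaction)

/-- The inclusion of `matrixComod hγ X` in `X^n`. -/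
def matrixIncl (X : Comod k A) : (matrixComod hγ X).carrier →ₗ[k] (Fin n → X.carrier) :=
  cornerIncl (hγ.isCoassociative X.isRightCoaction)

theorem matrixIncl_injective (X : Comod k A) : Function.Injective (matrixIncl hγ X) :=
  cornerIncl_injective _

theorem matrixIncl_apply_eq (X : Comod k A) (x : (matrixComod hγ X).carrier) (j : Fin n) :
    ∑ l, dualAct X.coact (Coalgebra.counit ∘ₗ γ j l) (matrixIncl hγ X x l) =
      matrixIncl hγ X x j := by
  rw [← counitProj_matrixCoact]
  exact congrFun (counitProj_cornerIncl _ x) j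

theorem matrixIncl_colinear (X : Comod k A) : matrixCoact γ X.coact ∘ₗ matrixIncl hγ X =
    (matrixIncl hγ X).rTensor B ∘ₗ (matrixComod hγ X).coact := cornerIncl_colinear _

/-- The functor `𝓜^A ⥤ 𝓜^B` given by a comultiplicative matrix. -/
def matrixFunctor : Comod k A ⥤ Comod k B where
  obj X := matrixComod hγ X
  map {X Y} f := cornerLift _ ((lin f).compLeft (Fin n) ∘ₗ matrixIncl hγ X) (by
    rw [← LinearMap.comp_assoc, matrixCoact_compLeft γ (lin_colinear f), LinearMap.comp_assoc,
      matrixIncl_colinear, LinearMap.rTensor_comp, LinearMap.comp_assoc])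
  map_id X := hom_ext fun x => matrixIncl_injective hγ X rfl
  map_comp {_ _ Z} _ _ := hom_ext fun x => matrixIncl_injective hγ Z rfl

instance : (matrixFunctor hγ).Additive where
  map_add {_ Y _ _} := hom_ext fun _ => matrixIncl_injective hγ Y rfl

instance : (matrixFunctor hγ).Linear k where
  map_smul {_ Y} _ _ := hom_ext fun _ => matrixIncl_injective hγ Y rfl

end

/-- Functionals `u`, `v` on `A` that identify an `A`-comodule `X` with the comodule obtained from
it by applying first the matrix `γ` and then the matrix `γ'`: the mutually inverse maps are
`x ↦ ((1 ⊗ u i j) r(x))` and `(x_{ij}) ↦ ∑ (1 ⊗ v j i) r(x_{ij})`. The conditions `sum_conv` and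
`conv` say that the two composites are the identity, `coact` that the first map is colinear, and
`fix` that its rows lie in the comodule obtained by applying `γ`. -/
structure MatrixUnit (γ : Fin n → Fin n → (A →ₗ[k] B)) (γ' : Fin m → Fin m → (B →ₗ[k] A))
    (u : Fin m → Fin n → (A →ₗ[k] k)) (v : Fin n → Fin m → (A →ₗ[k] k)) : Prop where
  sum_conv : ∑ i, ∑ j, v j i ∘ₗ dualAct Coalgebra.comul (u i j) = Coalgebra.counit
  conv : ∀ i l j p, u i j ∘ₗ dualAct Coalgebra.comul (v l p) =
    Coalgebra.counit ∘ₗ γ' i p ∘ₗ γ j l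
  coact : ∀ i j, ∑ p, ∑ l, γ' i p ∘ₗ γ j l ∘ₗ dualAct Coalgebra.comul (u p l) =
    dualActLeft (u i j)
  fix : ∀ i j, ∑ l, (Coalgebra.counit ∘ₗ γ j l) ∘ₗ dualAct Coalgebra.comul (u i l) = u i j

section

variable {γ : Fin n → Fin n → (A →ₗ[k] B)} (hγ : IsComultiplicative γ)
variable {γ' : Fin m → Fin m → (B →ₗ[k] A)} (hγ' : IsComultiplicative γ')
variable {u : Fin m → Fin n → (A →ₗ[k] k)} {v : Fin n → Fin m → (A →ₗ[k] k)}

/-- The map `x ↦ ((1 ⊗ u i j) r(x))_j` with values in `matrixComod hγ X`. -/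
def unitRow (hu : MatrixUnit γ γ' u v) (X : Comod k A) (i : Fin m) :
    X.carrier →ₗ[k] (matrixComod hγ X).carrier :=
  LinearMap.codRestrict (LinearMap.range (counitProj (matrixCoact γ X.coact)))
    (LinearMap.pi fun j => dualAct X.coact (u i j)) (fun x => LinearMap.mem_range.2
      ⟨fun j => dualAct X.coact (u i j) x, by
        ext j
        rw [counitProj_matrixCoact]
        simp only [X.isRightCoaction.dualAct_dualAct]
        rw [← dualAct_sum, hu.fix]
        rfl⟩)

/-- The components of the coaction of `matrixComod hγ X`, followed by a linear map `g` on `B`. -/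
theorem proj_matrixIncl_coact (X : Comod k A) (j : Fin n) (W : Type u) [AddCommGroup W]
    [Module k W] (g : B →ₗ[k] W) (y : (matrixComod hγ X).carrier) :
    (LinearMap.proj (R := k) (φ := fun _ : Fin n => X.carrier) j ∘ₗ matrixIncl hγ X).rTensor W
      (g.lTensor _ ((matrixComod hγ X).coact y)) =
    ∑ l, (g ∘ₗ γ j l).lTensor X.carrier (X.coact (matrixIncl hγ X y l)) := by
  rw [LinearMap.rTensor_comp_apply, ← nat_right g (matrixIncl_colinear hγ X)]
  have : ∀ t : (Fin n → X.carrier) ⊗[k] B,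
      (LinearMap.proj (R := k) (φ := fun _ : Fin n => X.carrier) j).rTensor W
        (g.lTensor _ t) = g.lTensor _
          ((LinearMap.proj (R := k) (φ := fun _ : Fin n => X.carrier) j).rTensor B t) := by
    intro t
    rw [← LinearMap.comp_apply, ← LinearMap.comp_apply (LinearMap.lTensor _ _),
      LinearMap.lTensor_comp_rTensor, LinearMap.rTensor_comp_lTensor]
  rw [this, proj_matrixCoact_apply, map_sum]
  simp only [LinearMap.lTensor_comp_apply]

theorem unitRow_colinear (hu : MatrixUnit γ γ' u v) (X : Comod k A) :
    matrixCoact γ' (matrixComod hγ X).coact ∘ₗ LinearMap.pi (unitRow hγ hu X) =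
      (LinearMap.pi (unitRow hγ hu X)).rTensor A ∘ₗ X.coact := by
  ext1 x
  apply pi_rTensor_ext
  intro i
  apply Module.Flat.rTensor_preserves_injective_linearMap (M := A) _ (matrixIncl_injective hγ X)
  apply pi_rTensor_ext
  intro j
  rw [LinearMap.comp_apply, LinearMap.comp_apply, proj_matrixCoact_apply,
    ← LinearMap.rTensor_comp_apply, map_sum]
  simp only [← LinearMap.rTensor_comp_apply, proj_matrixIncl_coact]
  have e : LinearMap.proj (R := k) (φ := fun _ : Fin n => X.carrier) j ∘ₗ matrixIncl hγ X ∘ₗ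
      LinearMap.proj (R := k) (φ := fun _ : Fin m => (matrixComod hγ X).carrier) i ∘ₗ
        LinearMap.pi (unitRow hγ hu X) = dualAct X.coact (u i j) := rfl
  rw [e, X.isRightCoaction.rTensor_dualAct, ← hu.coact]
  simp only [lTensor_sum_apply]
  refine Finset.sum_congr rfl fun p _ => Finset.sum_congr rfl fun l _ => ?_
  exact (X.isRightCoaction.coact_dualAct (γ' i p ∘ₗ γ j l) (u p l) x)

theorem dualAct_colinear {X Y : Comod k A} (f : X ⟶ Y) (a : A →ₗ[k] k) (x : X.carrier) :
    dualAct Y.coact a (lin f x) = lin f (dualAct X.coact a x) := by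
  rw [dualAct_apply, dualAct_apply, nat_right _ (lin_colinear f)]
  generalize a.lTensor X.carrier (X.coact x) = t
  have : (TensorProduct.rid k Y.carrier).toLinearMap ∘ₗ (lin f).rTensor k =
    lin f ∘ₗ (TensorProduct.rid k X.carrier).toLinearMap := by ext; simp
  exact LinearMap.congr_fun this t

/-- The map `x ↦ ((1 ⊗ u i j) r(x))` from `X` to the comodule obtained by applying `γ` and then
`γ'`. -/
def unitHom (hu : MatrixUnit γ γ' u v) (X : Comod k A) :
    X ⟶ matrixComod hγ' (matrixComod hγ X) :=
  cornerLift _ (LinearMap.pi (unitRow hγ hu X)) (unitRow_colinear hγ hu X)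

theorem matrixIncl_unitHom (hu : MatrixUnit γ γ' u v) (X : Comod k A) (x : X.carrier)
    (i : Fin m) (j : Fin n) :
    matrixIncl hγ X (matrixIncl hγ' _ (lin (unitHom hγ hγ' hu X) x) i) j =
      dualAct X.coact (u i j) x := rfl

/-- The map `(x_{ij}) ↦ ∑ (1 ⊗ v j i) r(x_{ij})`, the inverse of `unitHom`. -/
def unitInv (v : Fin n → Fin m → (A →ₗ[k] k)) (X : Comod k A) :
    (matrixComod hγ' (matrixComod hγ X)).carrier →ₗ[k] X.carrier :=
  ∑ i, ∑ j, dualAct X.coact (v j i) ∘ₗ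
    LinearMap.proj (R := k) (φ := fun _ : Fin n => X.carrier) j ∘ₗ matrixIncl hγ X ∘ₗ
    LinearMap.proj (R := k) (φ := fun _ : Fin m => (matrixComod hγ X).carrier) i ∘ₗ
    matrixIncl hγ' _

theorem unitInv_apply (X : Comod k A) (z : (matrixComod hγ' (matrixComod hγ X)).carrier) :
    unitInv hγ hγ' v X z =
      ∑ i, ∑ j, dualAct X.coact (v j i) (matrixIncl hγ X (matrixIncl hγ' _ z i) j) := by
  simp only [unitInv, LinearMap.sum_apply, LinearMap.comp_apply, LinearMap.proj_apply]

theorem unitInv_unitHom (hu : MatrixUnit γ γ' u v) (X : Comod k A) (x : X.carrier) :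
    unitInv hγ hγ' v X (lin (unitHom hγ hγ' hu X) x) = x := by
  rw [unitInv_apply]
  simp only [matrixIncl_unitHom, X.isRightCoaction.dualAct_dualAct, ← dualAct_sum]
  rw [hu.sum_conv, X.isRightCoaction.dualAct_counit]

theorem unitHom_unitInv (hu : MatrixUnit γ γ' u v) (X : Comod k A)
    (z : (matrixComod hγ' (matrixComod hγ X)).carrier) :
    lin (unitHom hγ hγ' hu X) (unitInv hγ hγ' v X z) = z := by
  apply matrixIncl_injective hγ'
  ext i : 1
  apply matrixIncl_injective hγ
  ext j : 1
  rw [matrixIncl_unitHom, unitInv_apply, ← matrixIncl_apply_eq hγ' _ z i]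
  simp only [map_sum, Finset.sum_apply, X.isRightCoaction.dualAct_dualAct, hu.conv]
  refine Finset.sum_congr rfl fun p _ => ?_
  have h := congrArg (TensorProduct.rid k X.carrier) (proj_matrixIncl_coact hγ X j k
    (Coalgebra.counit ∘ₗ γ' i p) (matrixIncl hγ' _ z p))
  rw [map_sum] at h
  refine Eq.trans h.symm ?_
  rw [dualAct_apply]
  generalize (Coalgebra.counit ∘ₗ γ' i p).lTensor (matrixComod hγ X).carrier
    ((matrixComod hγ X).coact (matrixIncl hγ' _ z p)) = t
  have : (TensorProduct.rid k X.carrier).toLinearMap ∘ₗ (LinearMap.proj (R := k)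
      (φ := fun _ : Fin n => X.carrier) j ∘ₗ matrixIncl hγ X).rTensor k =
      (LinearMap.proj (R := k) (φ := fun _ : Fin n => X.carrier) j ∘ₗ matrixIncl hγ X) ∘ₗ
        (TensorProduct.rid k _).toLinearMap := by ext; simp
  exact LinearMap.congr_fun this t

/-- Two matrices linked by a `MatrixUnit` compose to the identity functor. -/
def unitIso (hu : MatrixUnit γ γ' u v) :
    𝟭 (Comod k A) ≅ matrixFunctor hγ ⋙ matrixFunctor hγ' :=
  NatIso.ofComponents (fun X => isoOfInverse (unitHom hγ hγ' hu X) (unitInv hγ hγ' v X)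
      (unitInv_unitHom hγ hγ' hu X) (unitHom_unitInv hγ hγ' hu X)) (fun {X Y} f => by
    apply hom_ext
    intro x
    apply matrixIncl_injective hγ'
    ext i : 1
    apply matrixIncl_injective hγ
    ext j : 1
    exact dualAct_colinear f (u i j) x)

variable {u' : Fin n → Fin m → (B →ₗ[k] k)} {v' : Fin m → Fin n → (B →ₗ[k] k)}

/-- The equivalence of comodule categories given by two mutually inverse matrices. -/
def matrixEquivalence (hu : MatrixUnit γ γ' u v) (hu' : MatrixUnit γ' γ u' v') :
    Comod k A ≌ Comod k B :=
  CategoryTheory.Equivalence.mk (matrixFunctor hγ) (matrixFunctor hγ') (unitIso hγ hγ' hu)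
    (unitIso hγ' hγ hu').symm

end

end Comod

/-! ### Direct summands of finite powers -/

section

variable {k : Type u} [Field k]
variable {B : Type u} [AddCommGroup B] [Module k B] [Coalgebra k B]
variable {V : Type u} [AddCommGroup V] [Module k V]
variable {W : Type u} [AddCommGroup W] [Module k W]
variable {Y : Type u} [AddCommGroup Y] [Module k Y]

theorem proj_powRight {n : ℕ} (r : V →ₗ[k] V ⊗[k] B) (j : Fin n) :
    r ∘ₗ LinearMap.proj (R := k) (φ := fun _ : Fin n => V) j =
      (LinearMap.proj (R := k) (φ := fun _ : Fin n => V) j).rTensor B ∘ₗ powRight n r := by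
  refine LinearMap.pi_ext' fun i => ?_
  rw [LinearMap.comp_assoc, LinearMap.comp_assoc, powRight_single, ← LinearMap.comp_assoc,
    ← LinearMap.comp_assoc, ← LinearMap.rTensor_comp, LinearMap.comp_assoc]
  by_cases h : i = j
  · subst h
    simp [LinearMap.proj_comp_single_same]
  · simp [LinearMap.proj_comp_single_ne _ _ _ _ (Ne.symm h)]

theorem fst_prodRight (r : V →ₗ[k] V ⊗[k] B) (s : W →ₗ[k] W ⊗[k] B) :
    r ∘ₗ LinearMap.fst k V W = (LinearMap.fst k V W).rTensor B ∘ₗ prodRight r s := by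
  refine LinearMap.prod_ext ?_ ?_
  · rw [LinearMap.comp_assoc, LinearMap.comp_assoc, prodRight, LinearMap.coprod_inl,
      ← LinearMap.comp_assoc (g := LinearMap.rTensor B _), ← LinearMap.rTensor_comp]
    simp [LinearMap.fst_comp_inl]
  · rw [LinearMap.comp_assoc, LinearMap.comp_assoc, prodRight, LinearMap.coprod_inr,
      ← LinearMap.comp_assoc (g := LinearMap.rTensor B _), ← LinearMap.rTensor_comp]
    simp [LinearMap.fst_comp_inr]

theorem snd_prodRight (r : V →ₗ[k] V ⊗[k] B) (s : W →ₗ[k] W ⊗[k] B) :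
    s ∘ₗ LinearMap.snd k V W = (LinearMap.snd k V W).rTensor B ∘ₗ prodRight r s := by
  refine LinearMap.prod_ext ?_ ?_
  · rw [LinearMap.comp_assoc, LinearMap.comp_assoc, prodRight, LinearMap.coprod_inl,
      ← LinearMap.comp_assoc (g := LinearMap.rTensor B _), ← LinearMap.rTensor_comp]
    simp [LinearMap.snd_comp_inl]
  · rw [LinearMap.comp_assoc, LinearMap.comp_assoc, prodRight, LinearMap.coprod_inr,
      ← LinearMap.comp_assoc (g := LinearMap.rTensor B _), ← LinearMap.rTensor_comp]
    simp [LinearMap.snd_comp_inr]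

theorem colinear_comp {r : V →ₗ[k] V ⊗[k] B} {s : W →ₗ[k] W ⊗[k] B} {t : Y →ₗ[k] Y ⊗[k] B}
    {f : V →ₗ[k] W} {g : W →ₗ[k] Y} (hg : t ∘ₗ g = g.rTensor B ∘ₗ s)
    (hf : s ∘ₗ f = f.rTensor B ∘ₗ r) : t ∘ₗ (g ∘ₗ f) = (g ∘ₗ f).rTensor B ∘ₗ r := by
  rw [← LinearMap.comp_assoc, hg, LinearMap.comp_assoc, hf, LinearMap.rTensor_comp,
    LinearMap.comp_assoc]

/-- A colinear isomorphism `V ⊕ W ≅ Y^n` amounts, as far as the summand `V` is concerned, to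
colinear maps `p i : V → Y` and `q i : Y → V` with `∑ q i p i = 1`. -/
theorem exists_colinear_of_prod_equiv_pow {n : ℕ} {rV : V →ₗ[k] V ⊗[k] B}
    {rW : W →ₗ[k] W ⊗[k] B} {rY : Y →ₗ[k] Y ⊗[k] B} (e : (V × W) ≃ₗ[k] (Fin n → Y))
    (he : ∀ x, powRight n rY (e x) = e.toLinearMap.rTensor B (prodRight rV rW x)) :
    ∃ (p : Fin n → (V →ₗ[k] Y)) (q : Fin n → (Y →ₗ[k] V)),
      (∀ i, rY ∘ₗ p i = (p i).rTensor B ∘ₗ rV) ∧ (∀ i, rV ∘ₗ q i = (q i).rTensor B ∘ₗ rY) ∧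
      ∑ i, q i ∘ₗ p i = LinearMap.id := by
  have he' : powRight n rY ∘ₗ e.toLinearMap = e.toLinearMap.rTensor B ∘ₗ prodRight rV rW :=
    LinearMap.ext he
  have hs : prodRight rV rW ∘ₗ e.symm.toLinearMap =
      e.symm.toLinearMap.rTensor B ∘ₗ powRight n rY := by
    refine LinearMap.ext fun y => ?_
    simp only [LinearMap.comp_apply]
    obtain ⟨z, rfl⟩ := e.surjective y
    rw [he, ← LinearMap.rTensor_comp_apply]
    simp
  refine ⟨fun i => LinearMap.proj i ∘ₗ e.toLinearMap ∘ₗ LinearMap.inl k V W,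
    fun i => LinearMap.fst k V W ∘ₗ e.symm.toLinearMap ∘ₗ LinearMap.single k (fun _ => Y) i,
    fun i => colinear_comp (proj_powRight rY i)
      (colinear_comp he' (LinearMap.coprod_inl _ _)),
    fun i => colinear_comp (fst_prodRight rV rW) (colinear_comp hs (powRight_single i)), ?_⟩
  ext x
  simp only [LinearMap.sum_apply, LinearMap.comp_apply, LinearMap.proj_apply, ← map_sum]
  rw [← pow_decomp]
  simp

end

namespace Comod

variable {k : Type u} [Field k]
variable {B : Type u} [AddCommGroup B] [Module k B] [Coalgebra k B]

/-- `M` is a direct summand of a finite power of `N`, expressed by comodule maps `p i : M → N` and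
`q i : N → M` with `∑ q i p i = 1`. -/
def IsSummandOfPow (M N : Comod k B) : Prop :=
  ∃ (n : ℕ) (p : Fin n → (M ⟶ N)) (q : Fin n → (N ⟶ M)), ∑ i, p i ≫ q i = 𝟙 M

/-- Idempotents split in the category of comodules: the image of `f` is the corner of the
coassociative map `ρ f`. -/
theorem exists_idempotent_splitting {N : Comod k B} (f : N ⟶ N) (hf : f ≫ f = f) :
    ∃ (P : Comod k B) (i : P ⟶ N) (s : N ⟶ P), i ≫ s = 𝟙 P ∧ s ≫ i = f := by
  have hl : lin f ∘ₗ lin f = lin f := congrArg lin hf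
  have hl' := fun x => LinearMap.congr_fun hl x
  simp only [LinearMap.comp_apply] at hl'
  have hc : IsCoassociative (N.coact ∘ₗ lin f) := by
    intro x
    rw [LinearMap.rTensor_comp_apply, LinearMap.comp_apply, ← lin_colinear_apply, hl',
      N.isRightCoaction.coassoc]
  have hp : ∀ x, counitProj (N.coact ∘ₗ lin f) x = lin f x := by
    intro x
    exact N.isRightCoaction.dualAct_counit (lin f x)
  have hi : ∀ x, lin f (cornerIncl hc x) = cornerIncl hc x := by
    intro x
    rw [← hp, counitProj_cornerIncl]
  refine ⟨corner _ hc, cornerDesc hc (lin f) ?_, cornerLift hc (lin f) ?_,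
    hom_ext fun x => cornerIncl_injective hc ?_, hom_ext fun x => ?_⟩
  · rw [← LinearMap.comp_assoc, ← lin_colinear, LinearMap.comp_assoc, hl]
  · rw [LinearMap.comp_assoc, hl, lin_colinear]
  · exact (congrArg (lin f) (hi x)).trans (hi x)
  · exact hl' x

/-- The inclusion of the `i`-th copy of `N` in `N^n`. -/
def powIn (N : Comod k B) {n : ℕ} (i : Fin n) : N ⟶ N.pow n :=
  homMk (N := N.pow n) (LinearMap.single k (fun _ => N.carrier) i) (powRight_single i)

/-- The projection of `N^n` onto its `i`-th copy of `N`. -/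
def powOut (N : Comod k B) {n : ℕ} (i : Fin n) : N.pow n ⟶ N :=
  homMk (M := N.pow n) (LinearMap.proj i) (proj_powRight _ i)

theorem powIn_powOut (N : Comod k B) {n : ℕ} (i j : Fin n) :
    N.powIn i ≫ N.powOut j = if i = j then 𝟙 N else 0 := by
  split_ifs with h
  · subst h
    exact hom_ext fun x => Pi.single_eq_same (M := fun _ => N.carrier) i x
  · exact hom_ext fun x => Pi.single_eq_of_ne (M := fun _ => N.carrier) (Ne.symm h) x

/-- The complement of `M` in `N^n` splits the idempotent `1 - T S`, where `S T = 1` for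
`T : M → N^n` and `S : N^n → M` with components `p i` and `q i`. -/
theorem IsSummandOfPow.exists_iso {M N : Comod k B} (h : IsSummandOfPow M N) :
    ∃ (n : ℕ) (P : Comod k B), Nonempty (M.prod P ≅ N.pow n) := by
  obtain ⟨n, p, q, hpq⟩ := h
  have hTS : (∑ i, p i ≫ N.powIn i) ≫ (∑ j, N.powOut j ≫ q j) = 𝟙 M := by
    rw [← hpq, Preadditive.sum_comp]
    refine Finset.sum_congr rfl fun i _ => ?_
    rw [Preadditive.comp_sum, Finset.sum_eq_single i]
    · rw [Category.assoc, ← Category.assoc (N.powIn i), powIn_powOut, if_pos rfl,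
        Category.id_comp]
    · intro j _ hj
      rw [Category.assoc, ← Category.assoc (N.powIn i), powIn_powOut, if_neg (Ne.symm hj)]
      simp
    · simp
  generalize (∑ i, p i ≫ N.powIn i) = T at hTS
  generalize (∑ j, N.powOut j ≫ q j) = S at hTS
  obtain ⟨P, i, s, his, hsi⟩ := exists_idempotent_splitting (𝟙 (N.pow n) - S ≫ T) (by
    simp only [Preadditive.sub_comp, Preadditive.comp_sub, Category.id_comp, Category.comp_id,
      Category.assoc]
    rw [← Category.assoc T S T, hTS, Category.id_comp]
    abel)
  -- The splitting `(i, s)` of `1 - T S` is complementary to `(T, S)`.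
  have hTs : T ≫ s = 0 := by
    have : T ≫ s = T ≫ (s ≫ i) ≫ s := by rw [Category.assoc, his, Category.comp_id]
    rw [this, hsi, Preadditive.sub_comp, Preadditive.comp_sub, Category.id_comp,
      Category.assoc, ← Category.assoc T S, hTS, Category.id_comp, sub_self]
  have hiS : i ≫ S = 0 := by
    have : i ≫ S = i ≫ (s ≫ i) ≫ S := by
      rw [Category.assoc, ← Category.assoc i s, his, Category.id_comp]
    rw [this, hsi, Preadditive.sub_comp, Preadditive.comp_sub, Category.id_comp,
      Category.assoc, hTS, Category.comp_id, sub_self]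
  let fst : M.prod P ⟶ M := homMk (M := M.prod P) (LinearMap.fst k _ _) (fst_prodRight _ _)
  let snd : M.prod P ⟶ P := homMk (M := M.prod P) (LinearMap.snd k _ _) (snd_prodRight _ _)
  let inl : M ⟶ M.prod P := homMk (N := M.prod P) (LinearMap.inl k _ _)
    (LinearMap.coprod_inl _ _)
  let inr : P ⟶ M.prod P := homMk (N := M.prod P) (LinearMap.inr k _ _)
    (LinearMap.coprod_inr _ _)
  have h1 : inl ≫ fst = 𝟙 M := rfl
  have h2 : inr ≫ snd = 𝟙 P := rfl
  have h3 : inl ≫ snd = 0 := rfl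
  have h4 : inr ≫ fst = 0 := rfl
  have h5 : fst ≫ inl + snd ≫ inr = 𝟙 (M.prod P) :=
    hom_ext fun x => (prod_decomp (k := k) (x : M.carrier × P.carrier)).symm
  refine ⟨n, P, ⟨fst ≫ T + snd ≫ i, S ≫ inl + s ≫ inr, ?_, ?_⟩⟩
  · rw [← h5, Preadditive.add_comp, Preadditive.comp_add, Preadditive.comp_add]
    simp only [Category.assoc]
    rw [← Category.assoc T S, hTS, ← Category.assoc T s, hTs, ← Category.assoc i S, hiS,
      ← Category.assoc i s, his]
    simp
  · rw [Preadditive.add_comp, Preadditive.comp_add, Preadditive.comp_add]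
    simp only [Category.assoc]
    rw [← Category.assoc inl fst, h1, ← Category.assoc inl snd, h3, ← Category.assoc inr fst, h4,
      ← Category.assoc inr snd, h2]
    simp [hsi]

theorem IsSummandOfPow.similar {M N : Comod k B} (h : IsSummandOfPow M N)
    (h' : IsSummandOfPow N M) : Similar M N := by
  obtain ⟨m, P, hP⟩ := h.exists_iso
  obtain ⟨n, Q, hQ⟩ := h'.exists_iso
  exact ⟨m, n, P, Q, hP, hQ⟩

end Comod

/-! ### Codepth two and similarity over the smaller coalgebra -/

section Codepth

variable {k : Type u} [Field k]
variable {C : Type u} [AddCommGroup C] [Module k C] [Coalgebra k C]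
variable {D : Type u} [AddCommGroup D] [Module k D] [Coalgebra k D]

theorem colinear_corestrict {V W : Type u} [AddCommGroup V] [Module k V] [AddCommGroup W]
    [Module k W] (φ : C →ₗc[k] D) {r : V →ₗ[k] V ⊗[k] C} {s : W →ₗ[k] W ⊗[k] C}
    {f : V →ₗ[k] W} (h : s ∘ₗ f = f.rTensor C ∘ₗ r) :
    corestrictRight φ s ∘ₗ f = f.rTensor D ∘ₗ corestrictRight φ r :=
  LinearMap.ext fun x => nat_right φ.toLinearMap h x

theorem corestrictRight_id {V : Type u} [AddCommGroup V] [Module k V] (r : V →ₗ[k] V ⊗[k] C) :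
    corestrictRight (CoalgHom.id k C) r = r := by
  ext x
  exact LinearMap.congr_fun (LinearMap.lTensor_id V C) (r x)

/-- The `(D, C)`-bicomodule isomorphism is in particular right `C`-colinear, hence right
`D`-colinear after corestriction along `φ`. -/
theorem isSummandOfPow_of_isLeftCodepthTwo (φ : C →ₗc[k] D) (h : IsLeftCodepthTwo φ) :
    (cotensorSquareOver φ).IsSummandOfPow (regularOver φ) := by
  obtain ⟨n, P, e, -, he⟩ := h
  obtain ⟨p, q, hp, hq, hpq⟩ := exists_colinear_of_prod_equiv_pow e he
  have h1 : ((cotensorSquare φ).corestrict φ (CoalgHom.id k C)).rcoact =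
    (cotensorSquare φ).rcoact := corestrictRight_id _
  have h2 : ((Bicomod.regular k C).corestrict φ (CoalgHom.id k C)).rcoact =
    (Bicomod.regular k C).rcoact := corestrictRight_id _
  rw [h1, h2] at hp hq
  exact ⟨n, fun i => Comod.homMk (M := cotensorSquareOver φ) (N := regularOver φ) (p i)
      (colinear_corestrict φ (hp i)),
    fun i => Comod.homMk (M := regularOver φ) (N := cotensorSquareOver φ) (q i)
      (colinear_corestrict φ (hq i)), Subtype.ext (by
        exact (map_sum (Submodule.subtype _) _ _).trans hpq)⟩

theorem isSummandOfPow_of_isRightCodepthTwo (φ : C →ₗc[k] D) (h : IsRightCodepthTwo φ) :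
    (cotensorSquareOver φ).IsSummandOfPow (regularOver φ) := by
  obtain ⟨n, P, e, -, he⟩ := h
  obtain ⟨p, q, hp, hq, hpq⟩ := exists_colinear_of_prod_equiv_pow e he
  exact ⟨n, fun i => Comod.homMk (M := cotensorSquareOver φ) (N := regularOver φ) (p i) (hp i),
    fun i => Comod.homMk (M := regularOver φ) (N := cotensorSquareOver φ) (q i) (hq i),
      Subtype.ext (by exact (map_sum (Submodule.subtype _) _ _).trans hpq)⟩

/-- The comultiplication takes values in `C □_D C`. -/
theorem comul_mem_cotensorSquare (φ : C →ₗc[k] D) (c : C) :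
    Coalgebra.comul c ∈ cotensorSubmodule
      (corestrictRight φ (Coalgebra.comul (R := k) (A := C)))
      (corestrictLeft φ (Coalgebra.comul (R := k) (A := C))) := by
  rw [cotensorSubmodule, LinearMap.mem_ker, cotensorMap, LinearMap.sub_apply, sub_eq_zero]
  have e1 : (corestrictLeft φ (Coalgebra.comul (R := k) (A := C))).lTensor C =
      (φ.toLinearMap.rTensor C).lTensor C ∘ₗ
        (Coalgebra.comul (R := k) (A := C)).lTensor C := by
    rw [corestrictLeft, LinearMap.lTensor_comp]
  have e2 : (TensorProduct.assoc k C D C).toLinearMap ∘ₗ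
      (corestrictRight φ (Coalgebra.comul (R := k) (A := C))).rTensor C =
      (φ.toLinearMap.rTensor C).lTensor C ∘ₗ (TensorProduct.assoc k C C C).toLinearMap ∘ₗ
        (Coalgebra.comul (R := k) (A := C)).rTensor C := by
    rw [corestrictRight, LinearMap.rTensor_comp]
    simp only [← LinearMap.comp_assoc]
    congr 1
    ext; simp
  rw [e1, e2]
  simp only [LinearMap.comp_apply, LinearEquiv.coe_coe, Coalgebra.coassoc_apply]

/-- `C` is a direct summand of `C □_D C` as a right comodule: the comultiplication
`C → C □_D C` is split by `ε ⊗ 1`. -/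
theorem regularOver_isSummandOfPow (φ : C →ₗc[k] D) :
    (regularOver φ).IsSummandOfPow (cotensorSquareOver φ) := by
  let K := cotensorSubmodule (corestrictRight φ (Coalgebra.comul (R := k) (A := C)))
      (corestrictLeft φ (Coalgebra.comul (R := k) (A := C)))
  let p : C →ₗ[k] K := (Coalgebra.comul (R := k) (A := C)).codRestrict K
    (comul_mem_cotensorSquare φ)
  let q : K →ₗ[k] C := (TensorProduct.lid k C).toLinearMap ∘ₗ
    (Coalgebra.counit (R := k) (A := C)).rTensor C ∘ₗ K.subtype
  obtain ⟨ρ, hρ⟩ : ∃ ρ : K →ₗ[k] K ⊗[k] C, ρ = (cotensorSquare φ).rcoact := ⟨_, rfl⟩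
  have hK : tensorRight C (corestrictRight (CoalgHom.id k C)
      (Coalgebra.comul (R := k) (A := C))) ∘ₗ K.subtype = K.subtype.rTensor C ∘ₗ ρ := by
    rw [hρ]
    exact restrictRight_spec _ _ _
  rw [corestrictRight_id] at hK
  have hp : ρ ∘ₗ p =
      p.rTensor C ∘ₗ Coalgebra.comul (R := k) (A := C) := by
    refine LinearMap.ext fun x => ?_
    apply Module.Flat.rTensor_preserves_injective_linearMap (M := C) _
      (Submodule.injective_subtype K)
    rw [LinearMap.comp_apply, LinearMap.comp_apply, ← LinearMap.rTensor_comp_apply]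
    refine (LinearMap.congr_fun hK (p x)).symm.trans ?_
    change (TensorProduct.assoc k C C C).symm ((Coalgebra.comul (R := k) (A := C)).lTensor C
      (Coalgebra.comul x)) = (Coalgebra.comul (R := k) (A := C)).rTensor C (Coalgebra.comul x)
    rw [← Coalgebra.coassoc_apply, LinearEquiv.symm_apply_apply]
  have hq : Coalgebra.comul (R := k) (A := C) ∘ₗ q =
      q.rTensor C ∘ₗ ρ := by
    have e : Coalgebra.comul (R := k) (A := C) ∘ₗ (TensorProduct.lid k C).toLinearMap ∘ₗ
        (Coalgebra.counit (R := k) (A := C)).rTensor C =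
        ((TensorProduct.lid k C).toLinearMap ∘ₗ
          (Coalgebra.counit (R := k) (A := C)).rTensor C).rTensor C ∘ₗ
            tensorRight C (Coalgebra.comul (R := k) (A := C)) := by
      apply TensorProduct.ext'
      intro x y
      simp only [tensorRight, LinearMap.comp_apply, LinearMap.rTensor_tmul,
        LinearMap.lTensor_tmul, LinearEquiv.coe_coe, TensorProduct.lid_tmul, map_smul]
      generalize Coalgebra.comul (R := k) y = t
      induction t with
      | zero => simp
      | add s t hs ht => simp only [smul_add, TensorProduct.tmul_add, map_add, hs, ht]
      | tmul a b => simp [TensorProduct.smul_tmul']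
    change (Coalgebra.comul (R := k) (A := C) ∘ₗ (TensorProduct.lid k C).toLinearMap ∘ₗ
        (Coalgebra.counit (R := k) (A := C)).rTensor C) ∘ₗ K.subtype =
      (((TensorProduct.lid k C).toLinearMap ∘ₗ (Coalgebra.counit (R := k) (A := C)).rTensor C) ∘ₗ
        K.subtype).rTensor C ∘ₗ ρ
    rw [e, LinearMap.comp_assoc, hK, LinearMap.rTensor_comp _ _ K.subtype, LinearMap.comp_assoc]
  rw [hρ] at hp hq
  refine ⟨1, fun _ => Comod.homMk (M := regularOver φ) (N := cotensorSquareOver φ) p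
      (colinear_corestrict φ hp), fun _ => Comod.homMk (M := cotensorSquareOver φ)
      (N := regularOver φ) q (colinear_corestrict φ hq), ?_⟩
  rw [Fin.sum_univ_one]
  refine Comod.hom_ext fun x => ?_
  have h (c : C) : TensorProduct.lid k C ((Coalgebra.counit (R := k) (A := C)).rTensor C
      (Coalgebra.comul c)) = c := by
    rw [Coalgebra.rTensor_counit_comul, TensorProduct.lid_tmul, one_smul]
  exact h x

end Codepth

/-! ### Maps between coendomorphism coalgebras -/

namespace Comod

variable {k : Type u} [Field k]
variable {D : Type u} [AddCommGroup D] [Module k D] [Coalgebra k D]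
variable {M N P : Comod k D}
variable {E : Type u} [AddCommGroup E] [Module k E] [Coalgebra k E]
variable {F : Type u} [AddCommGroup F] [Module k F] [Coalgebra k F]
variable {G : Type u} [AddCommGroup G] [Module k G] [Coalgebra k G]
variable {W : Type u} [AddCommGroup W] [Module k W]
variable {W' : Type u} [AddCommGroup W'] [Module k W']
variable {θM : M.carrier →ₗ[k] E ⊗[k] M.carrier}
variable {θN : N.carrier →ₗ[k] F ⊗[k] N.carrier}
variable {θP : P.carrier →ₗ[k] G ⊗[k] P.carrier}

theorem rTensor_colinear (g : W →ₗ[k] W') (M : Comod k D) :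
    tensorRight W' M.coact ∘ₗ g.rTensor M.carrier =
      (g.rTensor M.carrier).rTensor D ∘ₗ tensorRight W M.coact := by
  apply TensorProduct.ext'
  intro w m
  simp only [tensorRight, LinearMap.comp_apply, LinearMap.rTensor_tmul, LinearMap.lTensor_tmul,
    LinearEquiv.coe_coe]
  generalize M.coact m = t
  induction t with
  | zero => simp
  | add s t hs ht => simp only [TensorProduct.tmul_add, map_add, hs, ht]
  | tmul a b => simp

theorem lTensor_colinear (W : Type u) [AddCommGroup W] [Module k W] (f : M ⟶ N) :
    tensorRight W N.coact ∘ₗ (lin f).lTensor W =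
      ((lin f).lTensor W).rTensor D ∘ₗ tensorRight W M.coact := by
  apply TensorProduct.ext'
  intro w m
  simp only [tensorRight, LinearMap.comp_apply, LinearMap.lTensor_tmul,
    LinearEquiv.coe_coe, lin_colinear_apply]
  generalize M.coact m = t
  induction t with
  | zero => simp
  | add s t hs ht => simp only [TensorProduct.tmul_add, map_add, hs, ht]
  | tmul a b => simp

theorem assoc_symm_colinear (W W' : Type u) [AddCommGroup W] [Module k W] [AddCommGroup W']
    [Module k W'] (M : Comod k D) :
    tensorRight (W ⊗[k] W') M.coact ∘ₗ (TensorProduct.assoc k W W' M.carrier).symm.toLinearMap =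
      ((TensorProduct.assoc k W W' M.carrier).symm.toLinearMap).rTensor D ∘ₗ
        tensorRight W (tensorRight W' M.coact) := by
  apply TensorProduct.ext_threefold'
  intro w w' m
  simp only [tensorRight, LinearMap.comp_apply, LinearMap.lTensor_tmul,
    LinearEquiv.coe_coe, TensorProduct.assoc_symm_tmul]
  generalize M.coact m = t
  induction t with
  | zero => simp
  | add s t hs ht => simp only [TensorProduct.tmul_add, map_add, hs, ht]
  | tmul a b => simp

namespace IsCoendomorphismCoalgebra

/-- Linear maps out of the coendomorphism coalgebra are determined by the maps that they induce
on `M`. -/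
theorem ext (hM : M.IsCoendomorphismCoalgebra E θM) {g g' : E →ₗ[k] W}
    (h : ∀ m, g.rTensor M.carrier (θM m) = g'.rTensor M.carrier (θM m)) : g = g' :=
  (hM.universal W (g'.rTensor M.carrier ∘ₗ θM)
    (colinear_comp (rTensor_colinear g' M) hM.colinear)).unique (LinearMap.ext h) rfl

/-- The linear map `g` out of the coendomorphism coalgebra with `(g ⊗ 1) θ = f`. -/
def lift (hM : M.IsCoendomorphismCoalgebra E θM) (f : M ⟶ M.tensor W) : E →ₗ[k] W :=
  (hM.universal W f.1 f.2).choose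

theorem lift_spec (hM : M.IsCoendomorphismCoalgebra E θM) (f : M ⟶ M.tensor W) (m : M.carrier) :
    (hM.lift f).rTensor M.carrier (θM m) = lin f m :=
  LinearMap.congr_fun (hM.universal W f.1 f.2).choose_spec.1 m

/-- For `f : M → N` and `r : N → M`, the linear map `γ` between coendomorphism coalgebras with
`(γ ⊗ 1) θ_M = (1 ⊗ r) θ_N f`. It is dual to the map `b ↦ r b f` of endomorphism algebras. -/
def transfer (hM : M.IsCoendomorphismCoalgebra E θM) (hN : N.IsCoendomorphismCoalgebra F θN)
    (f : M ⟶ N) (r : N ⟶ M) : E →ₗ[k] F :=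
  hM.lift (homMk (N := M.tensor F) ((lin r).lTensor F ∘ₗ θN ∘ₗ lin f)
    (colinear_comp (lTensor_colinear F r) (colinear_comp hN.colinear (lin_colinear f))))

/-- For `f : M → N`, `g : N → P` and `r : P → M`, the linear map `δ` with
`(δ ⊗ 1) θ_M = (1 ⊗ 1 ⊗ r) (1 ⊗ θ_P) (1 ⊗ g) θ_N f`. -/
def transferTwo (hM : M.IsCoendomorphismCoalgebra E θM) (hN : N.IsCoendomorphismCoalgebra F θN)
    (hP : P.IsCoendomorphismCoalgebra G θP) (f : M ⟶ N) (g : N ⟶ P) (r : P ⟶ M) :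
    E →ₗ[k] F ⊗[k] G :=
  hM.lift (homMk (N := M.tensor (F ⊗[k] G))
    ((TensorProduct.assoc k F G M.carrier).symm.toLinearMap ∘ₗ
      ((lin r).lTensor G ∘ₗ θP ∘ₗ lin g).lTensor F ∘ₗ θN ∘ₗ lin f)
    (colinear_comp (assoc_symm_colinear F G M) (colinear_comp
      (lTensor_colinear (M := N) (N := M.tensor G) F (homMk (N := M.tensor G)
        ((lin r).lTensor G ∘ₗ θP ∘ₗ lin g) (colinear_comp (lTensor_colinear G r)
          (colinear_comp hP.colinear (lin_colinear g)))))
      (colinear_comp hN.colinear (lin_colinear f)))))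

section

variable (hM : M.IsCoendomorphismCoalgebra E θM) (hN : N.IsCoendomorphismCoalgebra F θN)
variable (hP : P.IsCoendomorphismCoalgebra G θP)

theorem transfer_spec (f : M ⟶ N) (r : N ⟶ M) (m : M.carrier) :
    (hM.transfer hN f r).rTensor M.carrier (θM m) = (lin r).lTensor F (θN (lin f m)) :=
  hM.lift_spec _ m

theorem transferTwo_spec (f : M ⟶ N) (g : N ⟶ P) (r : P ⟶ M) (m : M.carrier) :
    (hM.transferTwo hN hP f g r).rTensor M.carrier (θM m) =
      (TensorProduct.assoc k F G M.carrier).symm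
        (((lin r).lTensor G ∘ₗ θP ∘ₗ lin g).lTensor F (θN (lin f m))) :=
  hM.lift_spec _ m

theorem transfer_id : hM.transfer hM (𝟙 M) (𝟙 M) = LinearMap.id :=
  hM.ext fun m => by rw [transfer_spec]; simp

theorem transfer_comp (f : M ⟶ N) (r : N ⟶ M) (f' : N ⟶ P) (r' : P ⟶ N) :
    hN.transfer hP f' r' ∘ₗ hM.transfer hN f r = hM.transfer hP (f ≫ f') (r' ≫ r) :=
  hM.ext fun m => by
    rw [LinearMap.rTensor_comp_apply, transfer_spec, transfer_spec, ← LinearMap.comp_apply,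
      LinearMap.rTensor_comp_lTensor, ← LinearMap.lTensor_comp_rTensor, LinearMap.comp_apply,
      transfer_spec, lin_comp, lin_comp, LinearMap.lTensor_comp_apply]
    rfl

theorem transfer_sum_left {ι : Type*} (s : Finset ι) (f : ι → (M ⟶ N)) (r : N ⟶ M) :
    hM.transfer hN (∑ i ∈ s, f i) r = ∑ i ∈ s, hM.transfer hN (f i) r :=
  hM.ext fun m => by
    have e : (∑ i ∈ s, hM.transfer hN (f i) r).rTensor M.carrier =
        ∑ i ∈ s, (hM.transfer hN (f i) r).rTensor M.carrier :=
      map_sum (LinearMap.rTensorHom M.carrier) _ _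
    rw [e, LinearMap.sum_apply]
    simp only [transfer_spec, map_sum, LinearMap.sum_apply]

theorem transfer_sum_right {ι : Type*} (s : Finset ι) (f : M ⟶ N) (r : ι → (N ⟶ M)) :
    hM.transfer hN f (∑ i ∈ s, r i) = ∑ i ∈ s, hM.transfer hN f (r i) :=
  hM.ext fun m => by
    have e : (∑ i ∈ s, hM.transfer hN f (r i)).rTensor M.carrier =
        ∑ i ∈ s, (hM.transfer hN f (r i)).rTensor M.carrier :=
      map_sum (LinearMap.rTensorHom M.carrier) _ _
    have e' : (lin (∑ i ∈ s, r i)).lTensor F = ∑ i ∈ s, (lin (r i)).lTensor F := by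
      rw [map_sum]
      exact map_sum (LinearMap.lTensorHom F) _ _
    rw [e, LinearMap.sum_apply]
    simp only [transfer_spec, e', LinearMap.sum_apply]

theorem transferTwo_sum {ι : Type*} (s : Finset ι) (f : M ⟶ N) (g : ι → (N ⟶ P)) (r : P ⟶ M) :
    hM.transferTwo hN hP f (∑ i ∈ s, g i) r = ∑ i ∈ s, hM.transferTwo hN hP f (g i) r :=
  hM.ext fun m => by
    have e : (∑ i ∈ s, hM.transferTwo hN hP f (g i) r).rTensor M.carrier =
        ∑ i ∈ s, (hM.transferTwo hN hP f (g i) r).rTensor M.carrier :=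
      map_sum (LinearMap.rTensorHom M.carrier) _ _
    have e' : ((lin r).lTensor G ∘ₗ θP ∘ₗ lin (∑ i ∈ s, g i)).lTensor F =
        ∑ i ∈ s, ((lin r).lTensor G ∘ₗ θP ∘ₗ lin (g i)).lTensor F := by
      have : (lin r).lTensor G ∘ₗ θP ∘ₗ lin (∑ i ∈ s, g i) =
          ∑ i ∈ s, (lin r).lTensor G ∘ₗ θP ∘ₗ lin (g i) := by
        ext x
        simp only [map_sum, LinearMap.comp_apply, LinearMap.sum_apply]
      rw [this]
      exact map_sum (LinearMap.lTensorHom F) _ _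
    rw [e, LinearMap.sum_apply, transferTwo_spec, e', LinearMap.sum_apply, map_sum]
    exact Finset.sum_congr rfl fun i _ => (transferTwo_spec hM hN hP f (g i) r m).symm

/-- With `map_transfer_comp_comul`, this reduces identities between the comultiplication and
transfers to identities between comodule maps. -/
theorem comul_comp_transfer (f : M ⟶ N) (r : N ⟶ M) :
    Coalgebra.comul ∘ₗ hM.transfer hN f r = hM.transferTwo hN hN f (𝟙 N) r :=
  hM.ext fun m => by
    rw [LinearMap.rTensor_comp_apply, transfer_spec, transferTwo_spec, lin_id,
      LinearMap.comp_id, LinearMap.lTensor_comp_apply, ← hN.isLeftCoaction.coassoc,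
      ← assoc_lTensor_lTensor, LinearEquiv.symm_apply_apply, ← LinearMap.comp_apply,
      LinearMap.rTensor_comp_lTensor, ← LinearMap.lTensor_comp_rTensor, LinearMap.comp_apply]

/-- A tensor product of two transfers after the comultiplication depends on the inner maps `r` and
`f'` only through their composite. -/
theorem map_transfer_comp_comul (f : M ⟶ N) (r : N ⟶ M) (f' : M ⟶ P) (r' : P ⟶ M) :
    TensorProduct.map (hM.transfer hN f r) (hM.transfer hP f' r') ∘ₗ Coalgebra.comul =
      hM.transferTwo hN hP f (r ≫ f') r' :=
  hM.ext fun m => by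
    have e : ∀ (g : E →ₗ[k] F) (g' : E →ₗ[k] G),
        (TensorProduct.map g g').rTensor M.carrier ∘ₗ
          (TensorProduct.assoc k E E M.carrier).symm.toLinearMap =
        (TensorProduct.assoc k F G M.carrier).symm.toLinearMap ∘ₗ
          (g'.rTensor M.carrier).lTensor F ∘ₗ g.rTensor _ := by
      intro g g'
      apply TensorProduct.ext_threefold'
      intros
      simp
    have h1 : (Coalgebra.comul (R := k) (A := E)).rTensor M.carrier (θM m) =
        (TensorProduct.assoc k E E M.carrier).symm (θM.lTensor E (θM m)) := by
      rw [← hM.isLeftCoaction.coassoc, LinearEquiv.symm_apply_apply]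
    have h2 : (hM.transfer hP f' r').rTensor M.carrier ∘ₗ θM =
        (lin r').lTensor G ∘ₗ θP ∘ₗ lin f' := LinearMap.ext (transfer_spec hM hP f' r')
    rw [LinearMap.rTensor_comp_apply, h1, transferTwo_spec]
    refine (LinearMap.congr_fun (e _ _) _).trans ?_
    simp only [LinearMap.comp_apply, LinearEquiv.coe_coe]
    congr 1
    rw [← LinearMap.comp_apply (LinearMap.rTensor _ _), LinearMap.rTensor_comp_lTensor,
      ← LinearMap.lTensor_comp_rTensor, LinearMap.comp_apply, transfer_spec,
      ← LinearMap.lTensor_comp_apply, ← LinearMap.lTensor_comp_apply, h2, lin_comp]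
    rfl

/-- The counit of a transfer depends only on the composite endomorphism of `M`. -/
theorem counit_comp_transfer (f : M ⟶ N) (r : N ⟶ M) :
    Coalgebra.counit ∘ₗ hM.transfer hN f r =
      Coalgebra.counit ∘ₗ hM.transfer hM (f ≫ r) (𝟙 M) :=
  hM.ext fun m => by
    rw [LinearMap.rTensor_comp_apply, LinearMap.rTensor_comp_apply, transfer_spec, transfer_spec,
      lin_id, LinearMap.lTensor_id, LinearMap.id_apply, hM.isLeftCoaction.counit,
      ← LinearMap.comp_apply, LinearMap.rTensor_comp_lTensor, ← LinearMap.lTensor_comp_rTensor,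
      LinearMap.comp_apply, hN.isLeftCoaction.counit, LinearMap.lTensor_tmul]
    rfl

/-- The functional on the coendomorphism coalgebra of `M` corresponding to an endomorphism of
`M`. -/
def functional (f : M ⟶ M) : E →ₗ[k] k := Coalgebra.counit ∘ₗ hM.transfer hM f (𝟙 M)

theorem functional_spec (f : M ⟶ M) (m : M.carrier) :
    (hM.functional f).rTensor M.carrier (θM m) = 1 ⊗ₜ lin f m := by
  rw [functional, LinearMap.rTensor_comp_apply, transfer_spec, lin_id, LinearMap.lTensor_id,
    LinearMap.id_apply, hM.isLeftCoaction.counit]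

theorem counit_comp_transfer_eq_functional (f : M ⟶ N) (r : N ⟶ M) :
    Coalgebra.counit ∘ₗ hM.transfer hN f r = hM.functional (f ≫ r) :=
  counit_comp_transfer hM hN f r

theorem functional_id : hM.functional (𝟙 M) = Coalgebra.counit := by
  rw [functional, transfer_id, LinearMap.comp_id]

theorem functional_sum {ι : Type*} (s : Finset ι) (f : ι → (M ⟶ M)) :
    hM.functional (∑ i ∈ s, f i) = ∑ i ∈ s, hM.functional (f i) := by
  refine LinearMap.ext fun x => ?_
  simp only [functional, transfer_sum_left, LinearMap.comp_apply, LinearMap.sum_apply, map_sum]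

theorem functional_comp_transfer (f : M ⟶ N) (r : N ⟶ M) (h : N ⟶ N) :
    hN.functional h ∘ₗ hM.transfer hN f r = hM.functional (f ≫ h ≫ r) := by
  rw [functional, LinearMap.comp_assoc, transfer_comp, counit_comp_transfer_eq_functional]
  simp

/-- The functional of `f` acts on the coalgebra as the transfer of the pair `(1, f)`. -/
theorem dualAct_functional (f : M ⟶ M) :
    dualAct Coalgebra.comul (hM.functional f) = hM.transfer hM (𝟙 M) f :=
  hM.ext fun m => by
    rw [transfer_spec, lin_id, LinearMap.id_apply, dualAct, LinearMap.rTensor_comp_apply,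
      LinearMap.rTensor_comp_apply]
    have h1 : (Coalgebra.comul (R := k) (A := E)).rTensor M.carrier (θM m) =
        (TensorProduct.assoc k E E M.carrier).symm (θM.lTensor E (θM m)) := by
      rw [← hM.isLeftCoaction.coassoc, LinearEquiv.symm_apply_apply]
    have e : ∀ g : E →ₗ[k] k, (TensorProduct.rid k E).toLinearMap.rTensor M.carrier ∘ₗ
        (g.lTensor E).rTensor M.carrier ∘ₗ
          (TensorProduct.assoc k E E M.carrier).symm.toLinearMap =
        (TensorProduct.lid k M.carrier).toLinearMap.lTensor E ∘ₗ
          (g.rTensor M.carrier).lTensor E := by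
      intro g
      apply TensorProduct.ext_threefold'
      intros
      simp [TensorProduct.smul_tmul]
    have h2 : (TensorProduct.lid k M.carrier).toLinearMap ∘ₗ
        (hM.functional f).rTensor M.carrier ∘ₗ θM = lin f := LinearMap.ext fun x => by
      simp [functional_spec]
    rw [h1]
    refine (LinearMap.congr_fun (e (hM.functional f)) _).trans ?_
    rw [LinearMap.comp_apply, ← LinearMap.lTensor_comp_apply, ← LinearMap.lTensor_comp_apply,
      LinearMap.comp_assoc, h2]

theorem dualActLeft_functional (f : M ⟶ M) :
    dualActLeft (hM.functional f) = hM.transfer hM f (𝟙 M) :=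
  hM.ext fun m => by
    rw [transfer_spec, lin_id, LinearMap.lTensor_id, LinearMap.id_apply, dualActLeft,
      LinearMap.rTensor_comp_apply, LinearMap.rTensor_comp_apply]
    have h1 : (Coalgebra.comul (R := k) (A := E)).rTensor M.carrier (θM m) =
        (TensorProduct.assoc k E E M.carrier).symm (θM.lTensor E (θM m)) := by
      rw [← hM.isLeftCoaction.coassoc, LinearEquiv.symm_apply_apply]
    have e : ∀ g : E →ₗ[k] k, (TensorProduct.lid k E).toLinearMap.rTensor M.carrier ∘ₗ
        (g.rTensor E).rTensor M.carrier ∘ₗ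
          (TensorProduct.assoc k E E M.carrier).symm.toLinearMap =
        (TensorProduct.lid k (E ⊗[k] M.carrier)).toLinearMap ∘ₗ g.rTensor _ := by
      intro g
      apply TensorProduct.ext_threefold'
      intros
      simp [TensorProduct.smul_tmul']
    rw [h1]
    refine (LinearMap.congr_fun (e (hM.functional f)) _).trans ?_
    rw [LinearMap.comp_apply, ← LinearMap.comp_apply (LinearMap.rTensor _ _),
      LinearMap.rTensor_comp_lTensor, ← LinearMap.lTensor_comp_rTensor, LinearMap.comp_apply,
      functional_spec]
    simp

end

end IsCoendomorphismCoalgebra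

end Comod

/-! ### Similar comodules have strongly equivalent coendomorphism coalgebras -/

namespace Comod

variable {k : Type u} [Field k]
variable {D : Type u} [AddCommGroup D] [Module k D] [Coalgebra k D]
variable {M N : Comod k D}
variable {E : Type u} [AddCommGroup E] [Module k E] [Coalgebra k E]
variable {F : Type u} [AddCommGroup F] [Module k F] [Coalgebra k F]
variable {θM : M.carrier →ₗ[k] E ⊗[k] M.carrier}
variable {θN : N.carrier →ₗ[k] F ⊗[k] N.carrier}

theorem sum_comp_assoc {X Y : Comod k D} {n : ℕ} {r : Fin n → (N ⟶ M)}
    {s : Fin n → (M ⟶ N)} (h : ∑ i, r i ≫ s i = 𝟙 N) (a : X ⟶ N) (b : N ⟶ Y) :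
    ∑ i, a ≫ r i ≫ s i ≫ b = a ≫ b := by
  rw [← Preadditive.comp_sum]
  congr 1
  simp only [← Category.assoc, ← Preadditive.sum_comp]
  rw [h, Category.id_comp]

namespace IsCoendomorphismCoalgebra

variable (hM : M.IsCoendomorphismCoalgebra E θM) (hN : N.IsCoendomorphismCoalgebra F θN)
variable {n m : ℕ} {r : Fin n → (N ⟶ M)} {s : Fin n → (M ⟶ N)}
variable {p : Fin m → (M ⟶ N)} {q : Fin m → (N ⟶ M)}

/-- The matrix of linear maps `E → F` given by maps `r j : N → M` and `s j : M → N`. -/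
def transferMatrix (r : Fin n → (N ⟶ M)) (s : Fin n → (M ⟶ N)) :
    Fin n → Fin n → (E →ₗ[k] F) :=
  fun j l => hM.transfer hN (s j) (r l)

/-- Comultiplicativity results from inserting `∑ s i r i = 1` between the two factors of the
comultiplication. -/
theorem isComultiplicative_transferMatrix (h : ∑ i, r i ≫ s i = 𝟙 N) :
    IsComultiplicative (hM.transferMatrix hN r s) := by
  intro j l
  simp only [transferMatrix, map_transfer_comp_comul, comul_comp_transfer]
  rw [← transferTwo_sum, h]

/-- The endomorphisms `q i s j` and `r j p i` of `M` provide the functionals that identify the two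
matrices of transfers as mutually inverse. -/
theorem matrixUnit (h : ∑ i, r i ≫ s i = 𝟙 N) (h' : ∑ i, p i ≫ q i = 𝟙 M) :
    MatrixUnit (hM.transferMatrix hN r s) (hN.transferMatrix hM p q)
      (fun i j => hM.functional (s j ≫ q i)) (fun j i => hM.functional (p i ≫ r j)) where
  sum_conv := by
    simp only [dualAct_functional, functional_comp_transfer, Category.id_comp, Category.assoc,
      ← functional_sum]
    simp only [sum_comp_assoc h, h', functional_id]
  conv i l j t := by
    rw [dualAct_functional, functional_comp_transfer, transferMatrix, transferMatrix,
      transfer_comp, counit_comp_transfer_eq_functional]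
    simp
  coact i j := by
    simp only [dualAct_functional, transferMatrix, transfer_comp, ← transfer_sum_right,
      dualActLeft_functional, Category.id_comp]
    simp only [sum_comp_assoc h, h']
  fix i j := by
    have e : ∀ l, (Coalgebra.counit ∘ₗ hM.transfer hN (s j) (r l)) ∘ₗ
        hM.transfer hM (𝟙 M) (s l ≫ q i) = hM.functional (s j ≫ r l ≫ s l ≫ q i) := by
      intro l
      rw [LinearMap.comp_assoc, transfer_comp, counit_comp_transfer_eq_functional]
      simp
    simp only [dualAct_functional, transferMatrix, e, ← functional_sum]
    rw [sum_comp_assoc h]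

/-- For `t : M → N`, the map `E^n → F` with components the transfers of `t` and `r j`. -/
def fromPow (r : Fin n → (N ⟶ M)) (t : M ⟶ N) : (Fin n → E) →ₗ[k] F :=
  ∑ j, hM.transfer hN t (r j) ∘ₗ LinearMap.proj (R := k) (φ := fun _ : Fin n => E) j

/-- For `t : N → M`, the map `F → E^n` with components the transfers of `t` and `s j`. -/
def toPow (s : Fin n → (M ⟶ N)) (t : N ⟶ M) : F →ₗ[k] (Fin n → E) :=
  LinearMap.pi fun j => hN.transfer hM t (s j)

theorem fromPow_apply (t : M ⟶ N) (x : Fin n → E) :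
    hM.fromPow hN r t x = ∑ j, hM.transfer hN t (r j) (x j) := by
  simp only [fromPow, LinearMap.sum_apply, LinearMap.comp_apply, LinearMap.proj_apply]

theorem toPow_apply (t : N ⟶ M) (y : F) (j : Fin n) :
    hM.toPow hN s t y j = hN.transfer hM t (s j) y := rfl

theorem fromPow_colinear (h : ∑ i, r i ≫ s i = 𝟙 N) (t : M ⟶ N) :
    Coalgebra.comul ∘ₗ hM.fromPow hN r t = (hM.fromPow hN r t).rTensor F ∘ₗ
      matrixCoact (hM.transferMatrix hN r s) Coalgebra.comul := by
  refine LinearMap.ext fun x => ?_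
  have e : (hM.fromPow hN r t).rTensor F = ∑ j, (hM.transfer hN t (r j) ∘ₗ
      LinearMap.proj (R := k) (φ := fun _ : Fin n => E) j).rTensor F :=
    map_sum (LinearMap.rTensorHom F) _ _
  have h1 : ∀ l, Coalgebra.comul (R := k) (hM.transfer hN t (r l) (x l)) =
      ∑ j, TensorProduct.map (hM.transfer hN t (r j)) (hM.transfer hN (s j) (r l))
        (Coalgebra.comul (R := k) (x l)) := by
    intro l
    have h2 : Coalgebra.comul ∘ₗ hM.transfer hN t (r l) =
        ∑ j, TensorProduct.map (hM.transfer hN t (r j)) (hM.transfer hN (s j) (r l)) ∘ₗ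
          Coalgebra.comul := by
      simp only [map_transfer_comp_comul, comul_comp_transfer]
      rw [← transferTwo_sum, h]
    have h3 := LinearMap.congr_fun h2 (x l)
    simpa only [LinearMap.sum_apply, LinearMap.comp_apply] using h3
  have h3 : ∀ j l, (hM.transfer hN t (r j)).rTensor F ((hM.transfer hN (s j) (r l)).lTensor E
      (Coalgebra.comul (R := k) (x l))) = TensorProduct.map (hM.transfer hN t (r j))
        (hM.transfer hN (s j) (r l)) (Coalgebra.comul (R := k) (x l)) := by
    intro j l
    rw [← LinearMap.comp_apply, LinearMap.rTensor_comp_lTensor]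
  rw [LinearMap.comp_apply, LinearMap.comp_apply, e, LinearMap.sum_apply, fromPow_apply, map_sum]
  simp only [LinearMap.rTensor_comp_apply, proj_matrixCoact_apply, map_sum, transferMatrix, h3]
  rw [Finset.sum_comm]
  simp only [← h1]

theorem toPow_colinear (h : ∑ i, r i ≫ s i = 𝟙 N) (h' : ∑ i, p i ≫ q i = 𝟙 M) (t : N ⟶ M) :
    matrixCoact (hM.transferMatrix hN r s) Coalgebra.comul ∘ₗ hM.toPow hN s t =
      (hM.toPow hN s t).rTensor F ∘ₗ Coalgebra.comul := by
  refine LinearMap.ext fun y => ?_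
  apply pi_rTensor_ext
  intro j
  have h1 : ∀ l, Coalgebra.comul ∘ₗ hN.transfer hM t (s l) =
        ∑ i, TensorProduct.map (hN.transfer hM t (p i)) (hN.transfer hM (q i) (s l)) ∘ₗ
          Coalgebra.comul := by
    intro l
    simp only [map_transfer_comp_comul, comul_comp_transfer]
    rw [← transferTwo_sum, h']
  have h3 : (hN.transfer hM t (s j)).rTensor F ∘ₗ Coalgebra.comul =
      hN.transferTwo hM hN t (s j) (𝟙 N) := by
    rw [LinearMap.rTensor, ← transfer_id hN, map_transfer_comp_comul, Category.comp_id]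
  have h4 : ∀ l, (hM.transfer hN (s j) (r l)).lTensor E ∘ₗ Coalgebra.comul ∘ₗ
      hN.transfer hM t (s l) = ∑ i, TensorProduct.map (hN.transfer hM t (p i))
        (hN.transfer hN (q i ≫ s j) (r l ≫ s l)) ∘ₗ Coalgebra.comul := by
    intro l
    rw [h1]
    refine LinearMap.ext fun z => ?_
    simp only [LinearMap.comp_apply, LinearMap.sum_apply, map_sum]
    refine Finset.sum_congr rfl fun i _ => ?_
    rw [← LinearMap.comp_apply, LinearMap.lTensor_comp_map, transfer_comp]
  have h5 : ∀ i, ∑ l, TensorProduct.map (hN.transfer hM t (p i))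
        (hN.transfer hN (q i ≫ s j) (r l ≫ s l)) ∘ₗ Coalgebra.comul =
      hN.transferTwo hM hN t (p i ≫ q i ≫ s j) (𝟙 N) := by
    intro i
    rw [← map_transfer_comp_comul, ← h, transfer_sum_right]
    refine LinearMap.ext fun z => ?_
    have : TensorProduct.map (hN.transfer hM t (p i))
        (∑ l, hN.transfer hN (q i ≫ s j) (r l ≫ s l)) =
        ∑ l, TensorProduct.map (hN.transfer hM t (p i))
          (hN.transfer hN (q i ≫ s j) (r l ≫ s l)) :=
      map_sum (TensorProduct.mapBilinear (RingHom.id k) F F E F (hN.transfer hM t (p i))) _ _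
    rw [this]
    simp only [LinearMap.comp_apply, LinearMap.sum_apply]
  -- Inserting `∑ q i p i = 1` brings both sides to the form of `map_transfer_comp_comul`; the
  -- sums over `l` and `i` then collapse by `∑ s l r l = 1` and `∑ q i p i = 1`.
  have h2 : ∑ l, (hM.transfer hN (s j) (r l)).lTensor E ∘ₗ Coalgebra.comul ∘ₗ
      hN.transfer hM t (s l) = (hN.transfer hM t (s j)).rTensor F ∘ₗ Coalgebra.comul := by
    simp only [h4]
    rw [Finset.sum_comm]
    simp only [h5]
    rw [← transferTwo_sum, h3]
    simp only [← Category.assoc, ← Preadditive.sum_comp]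
    rw [h', Category.id_comp]
  rw [LinearMap.comp_apply, LinearMap.comp_apply, ← LinearMap.rTensor_comp_apply,
    proj_matrixCoact_apply]
  refine Eq.trans ?_ (LinearMap.congr_fun h2 y)
  rw [LinearMap.sum_apply]
  rfl

theorem sum_toPow_fromPow (h' : ∑ i, p i ≫ q i = 𝟙 M) (x : Fin n → E) :
    ∑ i, hM.toPow hN s (q i) (hM.fromPow hN r (p i) x) =
      counitProj (matrixCoact (hM.transferMatrix hN r s) Coalgebra.comul) x := by
  ext j
  rw [Finset.sum_apply, counitProj_matrixCoact]
  have e : ∀ i l, hN.transfer hM (q i) (s j) (hM.transfer hN (p i) (r l) (x l)) =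
      hM.transfer hM (p i ≫ q i) (s j ≫ r l) (x l) := fun i l =>
    LinearMap.congr_fun (transfer_comp hM hN hM (p i) (r l) (q i) (s j)) (x l)
  simp only [toPow_apply, fromPow_apply, map_sum, e]
  rw [Finset.sum_comm]
  refine Finset.sum_congr rfl fun l _ => ?_
  rw [transferMatrix, counit_comp_transfer_eq_functional, dualAct_functional,
    ← LinearMap.sum_apply, ← transfer_sum_left, h']

theorem sum_fromPow_toPow (h : ∑ i, r i ≫ s i = 𝟙 N) (y : F) :
    ∑ i, hM.fromPow hN r (s i) (hM.toPow hN s (r i) y) = y := by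
  have e : ∀ i j, hM.transfer hN (s i) (r j) (hN.transfer hM (r i) (s j) y) =
      hN.transfer hN (r i ≫ s i) (r j ≫ s j) y := fun i j =>
    LinearMap.congr_fun (transfer_comp hN hM hN (r i) (s j) (s i) (r j)) y
  simp only [toPow_apply, fromPow_apply, e, ← LinearMap.sum_apply, ← transfer_sum_right,
    ← transfer_sum_left]
  rw [h, transfer_id, LinearMap.id_apply]

/-- For `t : M → N`, the comodule map to `F` from the image of `E` under the functor of the
transfer matrix. -/
def fromMatrixComod (h : ∑ i, r i ≫ s i = 𝟙 N) (t : M ⟶ N) :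
    matrixComod (isComultiplicative_transferMatrix hM hN h) (regular k E) ⟶ regular k F :=
  cornerDesc (M := regular k F)
    ((isComultiplicative_transferMatrix hM hN h).isCoassociative (regular k E).isRightCoaction)
    (hM.fromPow hN r t) (hM.fromPow_colinear hN h t)

/-- For `t : N → M`, the comodule map from `F` to the image of `E` under the functor of the
transfer matrix. -/
def toMatrixComod (h : ∑ i, r i ≫ s i = 𝟙 N) (h' : ∑ i, p i ≫ q i = 𝟙 M) (t : N ⟶ M) :
    regular k F ⟶ matrixComod (isComultiplicative_transferMatrix hM hN h) (regular k E) :=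
  cornerLift (M := regular k F)
    ((isComultiplicative_transferMatrix hM hN h).isCoassociative (regular k E).isRightCoaction)
    (hM.toPow hN s t) (hM.toPow_colinear hN h h' t)

theorem matrixComod_isSummandOfPow (h : ∑ i, r i ≫ s i = 𝟙 N) (h' : ∑ i, p i ≫ q i = 𝟙 M) :
    (matrixComod (isComultiplicative_transferMatrix hM hN h) (regular k E)).IsSummandOfPow
      (regular k F) := by
  refine ⟨m, fun i => fromMatrixComod hM hN h (p i), fun i => toMatrixComod hM hN h h' (q i), ?_⟩
  refine hom_ext fun z => matrixIncl_injective _ _ ?_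
  rw [lin_sum_apply, map_sum]
  exact (hM.sum_toPow_fromPow hN h' _).trans (counitProj_cornerIncl _ z)

theorem isSummandOfPow_matrixComod (h : ∑ i, r i ≫ s i = 𝟙 N) (h' : ∑ i, p i ≫ q i = 𝟙 M) :
    (regular k F).IsSummandOfPow
      (matrixComod (isComultiplicative_transferMatrix hM hN h) (regular k E)) := by
  refine ⟨n, fun i => toMatrixComod hM hN h h' (r i), fun i => fromMatrixComod hM hN h (s i), ?_⟩
  refine hom_ext fun y => ?_
  rw [lin_sum_apply]
  exact hM.sum_fromPow_toPow hN h y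

end IsCoendomorphismCoalgebra

/-- Comodules that are summands of powers of each other have strongly equivalent coendomorphism
coalgebras. -/
theorem IsSummandOfPow.stronglyEquivalent (hM : M.IsCoendomorphismCoalgebra E θM)
    (hN : N.IsCoendomorphismCoalgebra F θN) (hMN : IsSummandOfPow M N)
    (hNM : IsSummandOfPow N M) : StronglyEquivalent k E F := by
  obtain ⟨m, p, q, h'⟩ := hMN
  obtain ⟨n, r, s, h⟩ := hNM
  have hγ := hM.isComultiplicative_transferMatrix hN h
  have hγ' := hN.isComultiplicative_transferMatrix hM h'
  exact ⟨matrixEquivalence hγ hγ' (hM.matrixUnit hN h h') (hN.matrixUnit hM h' h),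
    inferInstanceAs (matrixFunctor hγ).Additive, inferInstanceAs ((matrixFunctor hγ).Linear k),
    (hM.matrixComod_isSummandOfPow hN h h').similar (hM.isSummandOfPow_matrixComod hN h h'),
    (hN.matrixComod_isSummandOfPow hM h' h).similar (hN.isSummandOfPow_matrixComod hM h' h)⟩

end Comod

/-! ### Separation of tensors by functionals -/

section Separation

variable {k : Type u} [Field k]
variable {V : Type u} [AddCommGroup V] [Module k V]
variable {W : Type u} [AddCommGroup W] [Module k W]
variable {X : Type u} [AddCommGroup X] [Module k X]

theorem eq_zero_of_lTensor_eq_zero {t : V ⊗[k] X} (h : ∀ d : X →ₗ[k] k, d.lTensor V t = 0) :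
    t = 0 := by
  classical
  let b := Module.Basis.ofVectorSpace k X
  apply (TensorProduct.equivFinsuppOfBasisRight (M := V) b).injective
  rw [map_zero]
  ext i
  rw [TensorProduct.equivFinsuppOfBasisRight_apply, h]
  simp

theorem eq_of_lTensor_eq {t t' : V ⊗[k] X} (h : ∀ d : X →ₗ[k] k, d.lTensor V t = d.lTensor V t') :
    t = t' :=
  sub_eq_zero.1 (eq_zero_of_lTensor_eq_zero fun d => by rw [map_sub, h, sub_self])

theorem lTensor_rTensor_comm {Y : Type u} [AddCommGroup Y] [Module k Y] (g : V →ₗ[k] W)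
    (h : X →ₗ[k] Y) (t : V ⊗[k] X) :
    h.lTensor W (g.rTensor X t) = g.rTensor Y (h.lTensor V t) := by
  rw [← LinearMap.comp_apply, LinearMap.lTensor_comp_rTensor, ← LinearMap.rTensor_comp_lTensor,
    LinearMap.comp_apply]

theorem rid_rTensor (g : V →ₗ[k] W) (t : V ⊗[k] k) :
    TensorProduct.rid k W (g.rTensor k t) = g (TensorProduct.rid k V t) := by
  have : (TensorProduct.rid k W).toLinearMap ∘ₗ g.rTensor k =
    g ∘ₗ (TensorProduct.rid k V).toLinearMap := by ext; simp
  exact LinearMap.congr_fun this t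

/-- A tensor vanishes if a separating family of functionals on the left factor annihilates it. -/
theorem eq_of_rTensor_eq {ι : Type*} {Φ : ι → (V →ₗ[k] k)}
    (hΦ : ∀ v, (∀ i, Φ i v = 0) → v = 0) {t t' : V ⊗[k] X}
    (h : ∀ i, (Φ i).rTensor X t = (Φ i).rTensor X t') : t = t' := by
  refine eq_of_lTensor_eq fun d => (TensorProduct.rid k V).injective (sub_eq_zero.1 (hΦ _ ?_))
  intro i
  rw [map_sub, ← rid_rTensor, ← rid_rTensor, ← lTensor_rTensor_comm, ← lTensor_rTensor_comm, h,
    sub_self]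

/-- A tensor lies in `K ⊗ X` if all its contractions with functionals on `X` lie in `K`. -/
theorem mem_range_rTensor_subtype {K : Submodule k V} {t : V ⊗[k] X}
    (h : ∀ d : X →ₗ[k] k, TensorProduct.rid k V (d.lTensor V t) ∈ K) :
    t ∈ LinearMap.range (K.subtype.rTensor X) := by
  have hex : Function.Exact (K.subtype.rTensor X) (K.mkQ.rTensor X) :=
    Module.Flat.rTensor_exact X (LinearMap.exact_subtype_mkQ K)
  refine (hex t).1 (eq_zero_of_lTensor_eq_zero fun d => (TensorProduct.rid k (V ⧸ K)).injective ?_)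
  rw [lTensor_rTensor_comm, rid_rTensor, map_zero, Submodule.mkQ_apply,
    Submodule.Quotient.mk_eq_zero]
  exact h d

theorem finiteDimensional_range_lTensor (t : V ⊗[k] X) :
    FiniteDimensional k (LinearMap.range
      ((LinearMap.lTensorHom (R := k) (N := X) (P := k) V).flip t)) := by
  induction t with
  | zero => rw [map_zero, LinearMap.range_zero]; infer_instance
  | add s t hs ht =>
    rw [map_add]
    exact Submodule.finiteDimensional_of_le (LinearMap.range_add_le _ _)
  | tmul v x =>
    refine Submodule.finiteDimensional_of_le (S₂ := Submodule.span k {v ⊗ₜ[k] (1 : k)}) ?_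
    rintro _ ⟨d, rfl⟩
    rw [Submodule.mem_span_singleton]
    exact ⟨d x, by simp [← TensorProduct.tmul_smul]⟩

end Separation

/-! ### Local finiteness of comodules -/

namespace Comod

variable {k : Type u} [Field k]
variable {C : Type u} [AddCommGroup C] [Module k C] [Coalgebra k C]

/-- Every element `m` of a comodule lies in a finite dimensional subcomodule, namely in the space
of all `(1 ⊗ a) ρ(m)` with `a` a functional on the coalgebra. -/
theorem exists_finiteDimensional_hom (M : Comod k C) (m : M.carrier) :
    ∃ (Y : Comod k C) (i : Y ⟶ M) (y : Y.carrier), FiniteDimensional k Y.carrier ∧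
      lin i y = m := by
  let L : (C →ₗ[k] k) →ₗ[k] M.carrier := (TensorProduct.rid k M.carrier).toLinearMap ∘ₗ
    (LinearMap.lTensorHom (R := k) (N := C) (P := k) M.carrier).flip (M.coact m)
  have hL : ∀ a, L a = dualAct M.coact a m := fun _ => rfl
  have hfin : FiniteDimensional k (LinearMap.range L) := by
    have := finiteDimensional_range_lTensor (M.coact m)
    rw [LinearMap.range_comp]
    infer_instance
  have hmem : ∀ x : LinearMap.range L,
      M.coact x ∈ LinearMap.range ((LinearMap.range L).subtype.rTensor C) := by
    rintro ⟨_, a, rfl⟩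
    refine mem_range_rTensor_subtype fun d => ⟨d ∘ₗ dualAct Coalgebra.comul a, ?_⟩
    rw [hL, ← M.isRightCoaction.dualAct_dualAct]
    rfl
  have hspec := restrictRight_spec M.coact (LinearMap.range L) hmem
  refine ⟨⟨LinearMap.range L, restrictRight M.coact (LinearMap.range L) hmem,
    IsRightCoaction.of_injective hspec (Submodule.injective_subtype _) M.isRightCoaction⟩,
    homMk (LinearMap.range L).subtype hspec, ⟨m, Coalgebra.counit, ?_⟩, hfin, rfl⟩
  rw [hL, M.isRightCoaction.dualAct_counit]

/-- Over a quasi-finite comodule, the images of an element under all endomorphisms span a finite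
dimensional space. -/
theorem IsQuasiFinite.finiteDimensional_range_eval {M : Comod k C} (hM : M.IsQuasiFinite)
    (m : M.carrier) :
    FiniteDimensional k (LinearMap.range (LinearMap.applyₗ m ∘ₗ (lin (M := M) (N := M)))) := by
  obtain ⟨Y, i, y, hY, rfl⟩ := M.exists_finiteDimensional_hom m
  have := hM Y hY
  let L : Com Y M →ₗ[k] M.carrier := LinearMap.applyₗ y ∘ₗ (Com Y M).subtype
  have : FiniteDimensional k (LinearMap.range L) := inferInstance
  refine Submodule.finiteDimensional_of_le (S₂ := LinearMap.range L) ?_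
  rintro _ ⟨f, rfl⟩
  exact ⟨(i ≫ f : Y ⟶ M), rfl⟩

/-! ### Existence of coendomorphism coalgebras -/

section Existence

variable {D : Type u} [AddCommGroup D] [Module k D] [Coalgebra k D] {M : Comod k D}

/-- The pairing `m ⊗ ξ ↦ (f ↦ ξ (f m))` of `M ⊗ M^*` with the endomorphisms of `M`. -/
def coefficient (M : Comod k D) :
    M.carrier ⊗[k] (M.carrier →ₗ[k] k) →ₗ[k] ((M ⟶ M) →ₗ[k] k) :=
  TensorProduct.lift (LinearMap.mk₂ k (fun m ξ => ξ ∘ₗ LinearMap.applyₗ m ∘ₗ lin)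
    (by intros; ext; simp) (by intros; ext; simp) (by intros; ext; simp) (by intros; ext; simp))

/-- The space of the functionals `f ↦ ∑ ξ_i (f m_i)` on the endomorphisms of `M`. -/
def CoefficientSpace (M : Comod k D) : Type u := LinearMap.range (coefficient M)

instance : AddCommGroup (CoefficientSpace M) :=
  inferInstanceAs (AddCommGroup (LinearMap.range (coefficient M)))

instance : Module k (CoefficientSpace M) :=
  inferInstanceAs (Module k (LinearMap.range (coefficient M)))

/-- The functional on endomorphisms given by an element of `M ⊗ M^*`. -/
def coefficientMk (M : Comod k D) :
    M.carrier ⊗[k] (M.carrier →ₗ[k] k) →ₗ[k] CoefficientSpace M :=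
  (coefficient M).rangeRestrict

theorem coefficientMk_surjective (M : Comod k D) : Function.Surjective (coefficientMk M) :=
  LinearMap.surjective_rangeRestrict _

/-- The functional `f ↦ ξ (f m)`. -/
def coef (m : M.carrier) (ξ : M.carrier →ₗ[k] k) : CoefficientSpace M :=
  coefficientMk M (m ⊗ₜ ξ)

/-- Evaluation of the elements of the coefficient space at an endomorphism. -/
def evalAt (f : M ⟶ M) : CoefficientSpace M →ₗ[k] k :=
  LinearMap.applyₗ f ∘ₗ (LinearMap.range (coefficient M)).subtype

theorem evalAt_coef (f : M ⟶ M) (m : M.carrier) (ξ : M.carrier →ₗ[k] k) :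
    evalAt f (coef m ξ) = ξ (lin f m) := rfl

theorem eq_of_evalAt {e e' : CoefficientSpace M} (h : ∀ f, evalAt f e = evalAt f e') : e = e' :=
  Subtype.ext (LinearMap.ext h)

theorem eq_zero_of_evalAt (e : CoefficientSpace M) (h : ∀ f, evalAt f e = 0) : e = 0 :=
  eq_of_evalAt fun f => by rw [h, map_zero]

theorem coefficientSpace_hom_ext {W : Type u} [AddCommGroup W] [Module k W]
    {g g' : CoefficientSpace M →ₗ[k] W}
    (h : ∀ (m : M.carrier) (ξ : M.carrier →ₗ[k] k), g (coef m ξ) = g' (coef m ξ)) : g = g' := by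
  have : g ∘ₗ coefficientMk M = g' ∘ₗ coefficientMk M := TensorProduct.ext' h
  exact (LinearMap.cancel_right (coefficientMk_surjective M)).1 this

/-- If `M` is quasi-finite, then `ξ ↦ coef m ξ` is represented by a tensor, because it depends only
on the restriction of `ξ` to the finite dimensional space spanned by all `f m`. -/
theorem IsQuasiFinite.exists_tensor (hM : M.IsQuasiFinite) (m : M.carrier) :
    ∃ t : CoefficientSpace M ⊗[k] M.carrier, ∀ ξ : M.carrier →ₗ[k] k,
      TensorProduct.rid k _ (ξ.lTensor _ t) = coef m ξ := by
  let K := LinearMap.range (LinearMap.applyₗ m ∘ₗ (lin (M := M) (N := M)))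
  have : FiniteDimensional k K := hM.finiteDimensional_range_eval m
  let b := Module.finBasis k K
  -- The coordinates on `K`, composed with a projection onto `K`, are functionals on all of `M`.
  obtain ⟨π, hπ⟩ := LinearMap.exists_leftInverse_of_injective K.subtype K.ker_subtype
  refine ⟨∑ j, coef m (b.coord j ∘ₗ π) ⊗ₜ (b j).1, fun ξ => eq_of_evalAt fun f => ?_⟩
  have hf : lin f m = K.subtype ⟨lin f m, f, rfl⟩ := rfl
  simp only [map_sum, LinearMap.lTensor_tmul, TensorProduct.rid_tmul, map_smul, evalAt_coef]
  generalize (⟨lin f m, f, rfl⟩ : K) = x at hf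
  have hx : π (K.subtype x) = x := LinearMap.congr_fun hπ x
  rw [hf]
  conv_rhs => rw [← b.sum_repr x]
  simp only [LinearMap.comp_apply, hx, map_sum, map_smul, smul_eq_mul, Module.Basis.coord_apply]
  exact Finset.sum_congr rfl fun j _ => mul_comm _ _

/-- The universal coaction of the coefficient space on a quasi-finite comodule. -/
def IsQuasiFinite.theta (hM : M.IsQuasiFinite) :
    M.carrier →ₗ[k] CoefficientSpace M ⊗[k] M.carrier where
  toFun m := (hM.exists_tensor m).choose
  map_add' m m' := eq_of_lTensor_eq fun ξ => (TensorProduct.rid k _).injective (by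
    rw [map_add, map_add, (hM.exists_tensor _).choose_spec, (hM.exists_tensor _).choose_spec,
      (hM.exists_tensor _).choose_spec]
    exact eq_of_evalAt fun f => by simp [evalAt_coef])
  map_smul' a m := eq_of_lTensor_eq fun ξ => (TensorProduct.rid k _).injective (by
    rw [map_smul, map_smul, (hM.exists_tensor _).choose_spec, (hM.exists_tensor _).choose_spec]
    exact eq_of_evalAt fun f => by simp [evalAt_coef])

theorem IsQuasiFinite.theta_spec (hM : M.IsQuasiFinite) (m : M.carrier)
    (ξ : M.carrier →ₗ[k] k) : TensorProduct.rid k _ (ξ.lTensor _ (hM.theta m)) = coef m ξ :=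
  (hM.exists_tensor m).choose_spec ξ

theorem IsQuasiFinite.evalAt_theta (hM : M.IsQuasiFinite) (f : M ⟶ M) (m : M.carrier) :
    (evalAt f).rTensor M.carrier (hM.theta m) = 1 ⊗ₜ lin f m :=
  eq_of_lTensor_eq fun ξ => (TensorProduct.rid k k).injective (by
    rw [lTensor_rTensor_comm, rid_rTensor, hM.theta_spec, evalAt_coef]
    simp)

theorem IsQuasiFinite.theta_colinear (hM : M.IsQuasiFinite) :
    hM.theta ∈ Com M (M.tensor (CoefficientSpace M)) := by
  refine LinearMap.ext fun m => ?_
  apply (TensorProduct.assoc k (CoefficientSpace M) M.carrier D).injective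
  apply eq_of_rTensor_eq (Φ := evalAt (M := M)) eq_zero_of_evalAt
  intro f
  have h1 : (evalAt f).rTensor (M.carrier ⊗[k] D) ∘ₗ
      (TensorProduct.assoc k (CoefficientSpace M) M.carrier D).toLinearMap =
      (TensorProduct.assoc k k M.carrier D).toLinearMap ∘ₗ
        ((evalAt f).rTensor M.carrier).rTensor D := by
    apply TensorProduct.ext_threefold
    intros
    simp
  have h2 : (evalAt f).rTensor M.carrier ∘ₗ hM.theta = TensorProduct.mk k k M.carrier 1 ∘ₗ lin f :=
    LinearMap.ext (hM.evalAt_theta f)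
  have h3 : TensorProduct.assoc k (CoefficientSpace M) M.carrier D
      (tensorRight (CoefficientSpace M) M.coact (hM.theta m)) =
      M.coact.lTensor _ (hM.theta m) := by
    rw [tensorRight, LinearMap.comp_apply, LinearEquiv.coe_coe, LinearEquiv.apply_symm_apply]
  have h4 : (TensorProduct.assoc k k M.carrier D).toLinearMap ∘ₗ
      (TensorProduct.mk k k M.carrier 1).rTensor D = TensorProduct.mk k k (M.carrier ⊗[k] D) 1 := by
    ext; simp
  have h5 := LinearMap.congr_fun h1 (hM.theta.rTensor D (M.coact m))
  simp only [LinearMap.comp_apply, LinearEquiv.coe_coe] at h5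
  refine (congrArg _ h3).trans (Eq.trans ?_ h5.symm)
  rw [← LinearMap.rTensor_comp_apply, h2, LinearMap.rTensor_comp_apply, ← lin_colinear_apply,
    ← lTensor_rTensor_comm, hM.evalAt_theta, LinearMap.lTensor_tmul]
  exact (LinearMap.congr_fun h4 _).symm

theorem lid_colinear (M : Comod k D) : M.coact ∘ₗ (TensorProduct.lid k M.carrier).toLinearMap =
    (TensorProduct.lid k M.carrier).toLinearMap.rTensor D ∘ₗ tensorRight k M.coact := by
  apply TensorProduct.ext'
  intro a m
  simp only [tensorRight, LinearMap.comp_apply, LinearMap.lTensor_tmul, LinearEquiv.coe_coe,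
    TensorProduct.lid_tmul, map_smul]
  generalize M.coact m = t
  induction t with
  | zero => simp
  | add s t hs ht => simp only [smul_add, TensorProduct.tmul_add, map_add, hs, ht]
  | tmul x y => simp [TensorProduct.smul_tmul']

/-- Every colinear map `M → W ⊗ M` factors through the universal coaction. -/
theorem IsQuasiFinite.theta_universal (hM : M.IsQuasiFinite) (W : Type u) [AddCommGroup W]
    [Module k W] (f : M.carrier →ₗ[k] W ⊗[k] M.carrier) (hf : f ∈ Com M (M.tensor W)) :
    ∃! g : CoefficientSpace M →ₗ[k] W, g.rTensor M.carrier ∘ₗ hM.theta = f := by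
  have hg : ∀ (g : CoefficientSpace M →ₗ[k] W) (m : M.carrier) (ξ : M.carrier →ₗ[k] k),
      TensorProduct.rid k W (ξ.lTensor W (g.rTensor M.carrier (hM.theta m))) = g (coef m ξ) := by
    intro g m ξ
    rw [lTensor_rTensor_comm, rid_rTensor, hM.theta_spec]
  let G : M.carrier ⊗[k] (M.carrier →ₗ[k] k) →ₗ[k] W :=
    TensorProduct.lift (LinearMap.mk₂ k (fun m ξ => TensorProduct.rid k W (ξ.lTensor W (f m)))
      (by intros; simp) (by intros; simp) (by intros; simp [LinearMap.lTensor_add])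
      (by intros; simp [LinearMap.lTensor_smul]))
  have hG : ∀ m ξ, G (m ⊗ₜ ξ) = TensorProduct.rid k W (ξ.lTensor W (f m)) := fun _ _ => rfl
  -- A functional `w` on `W` turns `f` into the endomorphism `(w ⊗ 1) f` of `M`, at which elements
  -- of the kernel of `coefficient M` vanish.
  have hker : ∀ t, coefficient M t = 0 → G t = 0 := by
    intro t ht
    refine (Module.forall_dual_apply_eq_zero_iff k (G t)).1 fun w => ?_
    let h : M ⟶ M := homMk ((TensorProduct.lid k M.carrier).toLinearMap ∘ₗ
      w.rTensor M.carrier ∘ₗ f) (colinear_comp (lid_colinear M)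
        (colinear_comp (rTensor_colinear w M) hf))
    have e : w ∘ₗ G = LinearMap.applyₗ h ∘ₗ coefficient M := by
      apply TensorProduct.ext'
      intro m ξ
      rw [LinearMap.comp_apply, hG, LinearMap.comp_apply]
      change _ = ξ (TensorProduct.lid k M.carrier (w.rTensor M.carrier (f m)))
      generalize f m = s
      induction s with
      | zero => simp
      | add s t hs ht => simp only [map_add, hs, ht]
      | tmul a b => simp [mul_comm]
    have e' := LinearMap.congr_fun e t
    rw [LinearMap.comp_apply, LinearMap.comp_apply, ht, map_zero] at e'
    exact e'
  -- A linear section of `coefficientMk M` factors `G` through the coefficient space.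
  obtain ⟨σ, hσ⟩ := LinearMap.exists_rightInverse_of_surjective (coefficientMk M)
    (LinearMap.range_eq_top.2 (coefficientMk_surjective M))
  have hσG : ∀ t, G (σ (coefficientMk M t)) = G t := by
    intro t
    rw [← sub_eq_zero, ← map_sub]
    apply hker
    rw [map_sub, sub_eq_zero]
    exact congrArg Subtype.val (LinearMap.congr_fun hσ (coefficientMk M t))
  refine ⟨G ∘ₗ σ, LinearMap.ext fun m => eq_of_lTensor_eq fun ξ =>
    (TensorProduct.rid k W).injective ?_, fun g' hg' => coefficientSpace_hom_ext fun m ξ => ?_⟩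
  · exact (hg _ m ξ).trans (hσG (m ⊗ₜ ξ))
  · rw [← hg, ← LinearMap.comp_apply (LinearMap.rTensor _ _), hg']
    exact (hσG (m ⊗ₜ ξ)).symm

/-- The universal property of a universal coaction `θ : M → E ⊗ M` provides `E` with the structure
of a coalgebra. -/
theorem exists_coalgebra_of_universal {E : Type u} [AddCommGroup E] [Module k E]
    {θ : M.carrier →ₗ[k] E ⊗[k] M.carrier} (hθ : θ ∈ Com M (M.tensor E))
    (hu : ∀ (W : Type u) [AddCommGroup W] [Module k W],
      ∀ f ∈ Com M (M.tensor W), ∃! g : E →ₗ[k] W, g.rTensor M.carrier ∘ₗ θ = f) :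
    ∃ _ : Coalgebra k E, M.IsCoendomorphismCoalgebra E θ := by
  have ext : ∀ {W : Type u} [AddCommGroup W] [Module k W] {g g' : E →ₗ[k] W}
      (_ : ∀ m, g.rTensor M.carrier (θ m) = g'.rTensor M.carrier (θ m)), g = g' := by
    intro W _ _ g g' h
    exact (hu W (g'.rTensor M.carrier ∘ₗ θ)
      (colinear_comp (rTensor_colinear g' M) hθ)).unique (LinearMap.ext h) rfl
  obtain ⟨Δ, hΔ, -⟩ := hu (E ⊗[k] E)
    ((TensorProduct.assoc k E E M.carrier).symm.toLinearMap ∘ₗ θ.lTensor E ∘ₗ θ)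
    (colinear_comp (assoc_symm_colinear E E M) (colinear_comp
      (lTensor_colinear (M := M) (N := M.tensor E) E (homMk (N := M.tensor E) θ hθ)) hθ))
  obtain ⟨ε, hε, -⟩ := hu k (TensorProduct.mk k k M.carrier 1) (by
    refine LinearMap.ext fun m => ?_
    change (TensorProduct.assoc k k M.carrier D).symm (1 ⊗ₜ M.coact m) =
      (TensorProduct.mk k k M.carrier 1).rTensor D (M.coact m)
    generalize M.coact m = t
    induction t with
    | zero => simp
    | add s t hs ht => simp only [TensorProduct.tmul_add, map_add, hs, ht]
    | tmul x y => simp)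
  have hΔ' : ∀ m, Δ.rTensor M.carrier (θ m) =
      (TensorProduct.assoc k E E M.carrier).symm (θ.lTensor E (θ m)) :=
    fun m => LinearMap.congr_fun hΔ m
  have hε' : ∀ m, ε.rTensor M.carrier (θ m) = 1 ⊗ₜ m := fun m => LinearMap.congr_fun hε m
  have hΔc : Δ.rTensor M.carrier ∘ₗ θ =
      (TensorProduct.assoc k E E M.carrier).symm.toLinearMap ∘ₗ θ.lTensor E ∘ₗ θ :=
    LinearMap.ext hΔ'
  have hεc : ε.rTensor M.carrier ∘ₗ θ = TensorProduct.mk k k M.carrier 1 := LinearMap.ext hε'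
  let inst : Coalgebra k E :=
    { comul := Δ
      counit := ε
      coassoc := ext fun m => by
        have n1 : (TensorProduct.assoc k E E E).toLinearMap.rTensor M.carrier ∘ₗ
            (Δ.rTensor E).rTensor M.carrier ∘ₗ
              (TensorProduct.assoc k E E M.carrier).symm.toLinearMap =
            (TensorProduct.assoc k E (E ⊗[k] E) M.carrier).symm.toLinearMap ∘ₗ
              (TensorProduct.assoc k E E M.carrier).symm.toLinearMap.lTensor E ∘ₗ
              (TensorProduct.assoc k E E (E ⊗[k] M.carrier)).toLinearMap ∘ₗ
              Δ.rTensor (E ⊗[k] M.carrier) := by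
          apply TensorProduct.ext_threefold'
          intro x y z
          simp only [LinearMap.comp_apply, LinearEquiv.coe_coe, TensorProduct.assoc_symm_tmul,
            LinearMap.rTensor_tmul]
          generalize Δ x = t
          induction t with
          | zero => simp
          | add s t hs ht => simp only [TensorProduct.add_tmul, map_add, hs, ht]
          | tmul a b => simp
        have n2 : (Δ.lTensor E).rTensor M.carrier ∘ₗ
            (TensorProduct.assoc k E E M.carrier).symm.toLinearMap =
            (TensorProduct.assoc k E (E ⊗[k] E) M.carrier).symm.toLinearMap ∘ₗ
              (Δ.rTensor M.carrier).lTensor E := by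
          apply TensorProduct.ext_threefold'
          intros
          simp
        have n5 : ∀ t, TensorProduct.assoc k E E (E ⊗[k] M.carrier) (θ.lTensor (E ⊗[k] E) t) =
            (θ.lTensor E).lTensor E (TensorProduct.assoc k E E M.carrier t) := by
          have : (TensorProduct.assoc k E E (E ⊗[k] M.carrier)).toLinearMap ∘ₗ
              θ.lTensor (E ⊗[k] E) = (θ.lTensor E).lTensor E ∘ₗ
                (TensorProduct.assoc k E E M.carrier).toLinearMap := by
            apply TensorProduct.ext_threefold
            intros
            simp
          exact LinearMap.congr_fun this
        have n3 := LinearMap.congr_fun n1 (θ.lTensor E (θ m))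
        have n4 := LinearMap.congr_fun n2 (θ.lTensor E (θ m))
        simp only [LinearMap.comp_apply, LinearEquiv.coe_coe] at n3 n4
        simp only [LinearMap.rTensor_comp_apply, hΔ']
        rw [n3, n4, ← lTensor_rTensor_comm, hΔ', ← LinearMap.lTensor_comp_apply, hΔc,
          LinearMap.lTensor_comp_apply, LinearMap.lTensor_comp_apply, n5,
          LinearEquiv.apply_symm_apply]
      rTensor_counit_comp_comul := ext fun m => by
        have n1 : (ε.rTensor E).rTensor M.carrier ∘ₗ
            (TensorProduct.assoc k E E M.carrier).symm.toLinearMap =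
            (TensorProduct.assoc k k E M.carrier).symm.toLinearMap ∘ₗ
              ε.rTensor (E ⊗[k] M.carrier) := by
          apply TensorProduct.ext_threefold'
          intros
          simp
        have n2 : (TensorProduct.assoc k k E M.carrier).symm.toLinearMap ∘ₗ
            TensorProduct.mk k k (E ⊗[k] M.carrier) 1 =
            (TensorProduct.mk k k E 1).rTensor M.carrier := by
          ext; simp
        have n3 := LinearMap.congr_fun n1 (θ.lTensor E (θ m))
        simp only [LinearMap.comp_apply, LinearEquiv.coe_coe] at n3
        rw [LinearMap.rTensor_comp_apply, hΔ', n3, ← lTensor_rTensor_comm, hε',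
          LinearMap.lTensor_tmul, ← n2]
        rfl
      lTensor_counit_comp_comul := ext fun m => by
        have n1 : (ε.lTensor E).rTensor M.carrier ∘ₗ
            (TensorProduct.assoc k E E M.carrier).symm.toLinearMap =
            (TensorProduct.assoc k E k M.carrier).symm.toLinearMap ∘ₗ
              (ε.rTensor M.carrier).lTensor E := by
          apply TensorProduct.ext_threefold'
          intros
          simp
        have n2 : (TensorProduct.assoc k E k M.carrier).symm.toLinearMap ∘ₗ
            (TensorProduct.mk k k M.carrier 1).lTensor E =
            ((TensorProduct.mk k E k).flip 1).rTensor M.carrier := by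
          ext; simp
        have n3 := LinearMap.congr_fun n1 (θ.lTensor E (θ m))
        simp only [LinearMap.comp_apply, LinearEquiv.coe_coe] at n3
        rw [LinearMap.rTensor_comp_apply, hΔ', n3, ← LinearMap.lTensor_comp_apply, hεc, ← n2]
        rfl }
  refine ⟨inst, hθ, hu, fun m => ?_, hε'⟩
  change TensorProduct.assoc k E E M.carrier (Δ.rTensor M.carrier (θ m)) = _
  rw [hΔ', LinearEquiv.apply_symm_apply]

theorem IsQuasiFinite.exists_isCoendomorphismCoalgebra (hM : M.IsQuasiFinite) :
    ∃ (E : Type u) (_ : AddCommGroup E) (_ : Module k E) (_ : Coalgebra k E)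
      (θ : M.carrier →ₗ[k] E ⊗[k] M.carrier), M.IsCoendomorphismCoalgebra E θ := by
  obtain ⟨inst, h⟩ := exists_coalgebra_of_universal hM.theta_colinear hM.theta_universal
  exact ⟨CoefficientSpace M, inferInstance, inferInstance, inst, hM.theta, h⟩

end Existence

end Comod

end

end CoalgebraTheory

theorem mainTheorem2 {k : Type u} [Field k]
    {C : Type u} [AddCommGroup C] [Module k C] [Coalgebra k C]
    {D : Type u} [AddCommGroup D] [Module k D] [Coalgebra k D]
    (φ : C →ₗc[k] D)
    (hφ : CoalgebraTheory.IsLeftCodepthTwo φ ∨ CoalgebraTheory.IsRightCodepthTwo φ)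
    (h₁ : (CoalgebraTheory.regularOver φ).IsQuasiFinite)
    (h₂ : (CoalgebraTheory.cotensorSquareOver φ).IsQuasiFinite) :
    (∃ (E : Type u) (_ : AddCommGroup E) (_ : Module k E) (_ : Coalgebra k E)
      (θ : (CoalgebraTheory.regularOver φ).carrier →ₗ[k]
        E ⊗[k] (CoalgebraTheory.regularOver φ).carrier),
      (CoalgebraTheory.regularOver φ).IsCoendomorphismCoalgebra E θ) ∧
    (∃ (E : Type u) (_ : AddCommGroup E) (_ : Module k E) (_ : Coalgebra k E)
      (θ : (CoalgebraTheory.cotensorSquareOver φ).carrier →ₗ[k]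
        E ⊗[k] (CoalgebraTheory.cotensorSquareOver φ).carrier),
      (CoalgebraTheory.cotensorSquareOver φ).IsCoendomorphismCoalgebra E θ) ∧
    (∀ (E₁ : Type u) [AddCommGroup E₁] [Module k E₁] [Coalgebra k E₁]
      (θ₁ : (CoalgebraTheory.regularOver φ).carrier →ₗ[k]
        E₁ ⊗[k] (CoalgebraTheory.regularOver φ).carrier)
      (E₂ : Type u) [AddCommGroup E₂] [Module k E₂] [Coalgebra k E₂]
      (θ₂ : (CoalgebraTheory.cotensorSquareOver φ).carrier →ₗ[k]
        E₂ ⊗[k] (CoalgebraTheory.cotensorSquareOver φ).carrier),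
      (CoalgebraTheory.regularOver φ).IsCoendomorphismCoalgebra E₁ θ₁ →
      (CoalgebraTheory.cotensorSquareOver φ).IsCoendomorphismCoalgebra E₂ θ₂ →
      CoalgebraTheory.StronglyEquivalent k E₁ E₂) := by
  have h : (CoalgebraTheory.cotensorSquareOver φ).IsSummandOfPow
      (CoalgebraTheory.regularOver φ) :=
    hφ.elim (CoalgebraTheory.isSummandOfPow_of_isLeftCodepthTwo φ)
      (CoalgebraTheory.isSummandOfPow_of_isRightCodepthTwo φ)
  exact ⟨h₁.exists_isCoendomorphismCoalgebra, h₂.exists_isCoendomorphismCoalgebra,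
    fun _ _ _ _ _ _ _ _ _ _ hE₁ hE₂ =>
      (CoalgebraTheory.regularOver_isSummandOfPow φ).stronglyEquivalent hE₁ hE₂ h⟩
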